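/- We work with unimodal $L_\mu$ formulas in positive normal form ($\phi ::= P \mid \neg P \mid X \mid \phi\wedge\phi \mid \phi\vee\phi \mid \Diamond\phi \mid \Box\phi \mid \mu X.\phi \mid \nu X.\phi \mid \bot \mid \top$), evaluated on regular, finitely branching trees labelled by propositional variables. A priority assignment for a sentence $\Psi$ with co-domain $I=\{m,\dots,q\}$, $m\in\{0,1\}$ ($I$ may be empty if $\Psi$ has no fixpoints), maps the bound variables of $\Psi$ to $I$, $\mu$-variables to odd and $\nu$-variables to even numbers; it is order preserving if $\Omega(X)\ge\Omega(Y)$ whenever $X$ is free in the formula binding $Y$. A sentence has index $I$ if it has an order preserving priority assignment with co-domain $I$. For a tree $\mathfrak T$ and a sentence $\Psi$ with priority assignment $\Omega_\Psi$ whose co-domain has minimal element $m$, $\mathfrak T\times\Psi$ is the model-checking parity game. Its positions are pairs $(s,\phi)$ of a state and a subformula, starting at (root, $\Psi$). The moves go from $(s,\Diamond\phi)$ and $(s,\Box\phi)$ to $(s',\phi)$ for the successors $s'$ of $s$, and from every other $(s,\phi)$ to $(s,\phi')$ for the immediate subformulas $\phi'$ of $\phi$, where the formula $\phi_X$ binding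 $X$ counts as the immediate subformula of $X$. Odd owns conjunctions, $\Box$-formulas, $\top$ and the literals true at $s$, and Even owns all other positions. A position $(s,X)$ has priority $\Omega_\Psi(X)$, and all others have priority $m$. A player who cannot move loses, and an infinite play is won by the parity of the highest priority seen infinitely often. $\mathfrak T\models\Psi$ means that Even wins $\mathfrak T\times\Psi$ for an order preserving $\Omega_\Psi$; sentences are equivalent if they hold in the same trees. The arena $\mathfrak T\times\Psi$ is also regarded as a tree (by unfolding it), whose nodes are labelled by $E_i$ or $O_i$ according to the owner (Even or Odd) and the priority $i$ of the position, and by $M$ if the position is of the form $(s,\Diamond\phi)$ or $(s,\Box\phi)$. A sentence $\mathsf{Win}$ interprets $\Psi$ (with $\Omega_\Psi$) if for all trees $\mathfrak T$: $\mathfrak T\models\Psi$ if and only if $\mathfrak T\times\Psi\models\mathsf{Win}$. The product $\Psi\times\mathsf{Win}$ of $\Psi$ with $\Omega_\Psi$, $m$ as above and $\mathsf{Win}$ with priority assignment $\Omega_{\mathsf{Win}}$ is computed, starting from the two sentences, by the following rules, where $\phi$ is a subformula of $\Psi$, the right factor is a subformula of $\mathsf{Win}$, and $\mathrm{im}(\phi)$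 is the set of immediate subformulas of $\phi$: * $\phi\times\top=\top$, $\phi\times\bot=\bot$, $\phi\times(\psi\wedge\psi')=(\phi\times\psi)\wedge(\phi\times\psi')$, $\phi\times(\psi\vee\psi')=(\phi\times\psi)\vee(\phi\times\psi')$; * for a literal $\phi=L$ (that is, $Q$ or $\neg Q$) with complement $\overline L$: $L\times E_m=\overline L$, $L\times O_m=L$, and $L\times P=\bot$ for other propositional variables $P$; for $\phi$ not a literal, $\phi\times P$ is $\top$ if the positions $(s,\phi)$ are labelled by $P$, and $\bot$ otherwise; $\phi\times\neg P$ is the complement of $\phi\times P$; * if $\phi$ is $\Diamond\phi'$ or $\Box\phi'$: $\phi\times\Box\psi=\Box(\phi'\times\psi)$ and $\phi\times\Diamond\psi=\Diamond(\phi'\times\psi)$; otherwise $\phi\times\Box\psi=\bigwedge_{\phi'\in\mathrm{im}(\phi)}\phi'\times\psi$ and $\phi\times\Diamond\psi=\bigvee_{\phi'\in\mathrm{im}(\phi)}\phi'\times\psi$; * for $\gamma\in\{\mu,\nu\}$: $\phi\times\gamma X.\psi_X=\gamma W_{\phi\times X}.(\phi\times\psi_X)$; * $\phi\times X=W_{\phi\times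 X}$ if this is reached inside a binding of $W_{\phi\times X}$ with no binding of some $W_{\phi'\times Z}$ with $\Omega_{\mathsf{Win}}(Z)>\Omega_{\mathsf{Win}}(X)$ in between; otherwise $\phi\times X=\gamma W_{\phi\times X}.(\phi\times\psi_X)$, where $\gamma$ is the fixpoint operator of $X$ and $\psi_X$ its binding formula. The priority of $W_{\phi\times X}$ is defined to be $\Omega_{\mathsf{Win}}(X)$. **Theorem.** Let $\Psi$ and $\mathsf{Win}$ be sentences of $L_\mu$, let $\Omega_\Psi$ be a priority assignment for $\Psi$, and let $\Omega_{\mathsf{Win}}$ be an order preserving priority assignment for $\mathsf{Win}$ with co-domain $I$ (so that $\mathsf{Win}$ has index $I$). Suppose that $\mathsf{Win}$ interprets $\Psi$. Then the computation of $\Psi\times\mathsf{Win}$ terminates. Its result is a sentence equivalent to $\Psi$, and the priority assignment that it inherits from $\mathsf{Win}$ is an order preserving priority assignment with co-domain $I$. In particular $\Psi$ is equivalent to a formula of the same index $I$ as $\mathsf{Win}$. Moreover, if in $\Psi$ and in $\mathsf{Win}$ every fixpoint variable is in the scope of a modality within its binding (the formulas are guarded), then so it is in $\Psi\times\mathsf{Win}$.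 -/

import Mathlib

namespace LMu

/-! ### Syntax -/

/-- The countably infinite set of propositional variables. It contains the variables `E i`, `O i`
and `M` that are used to encode parity games as trees. -/
inductive PropVar : Type
  | E (i : ℕ)
  | O (i : ℕ)
  | M
  | atom (k : ℕ)
  deriving DecidableEq

/-- Formulas of the unimodal mu-calculus in positive normal form, up to renaming of bound
variables: `var i` refers to the `i`-th enclosing binder, counted from the inside (de Bruijn).
Every binder carries a label in `κ`. -/
inductive Fml (κ : Type) : Type
  | pos (P : PropVar)
  | neg (P : PropVar)
  | var (i : ℕ)
  | and (φ ψ : Fml κ)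
  | or (φ ψ : Fml κ)
  | dia (φ : Fml κ)
  | box (φ : Fml κ)
  | fix (k : κ) (φ : Fml κ)
  | bot
  | top
  deriving DecidableEq

/-- The two fixpoint operators. -/
inductive FP : Type
  | mu
  | nu
  deriving DecidableEq

/-- Formulas of the mu-calculus: every binder is a `μ` or a `ν`. -/
abbrev Formula : Type := Fml FP

/-- Formulas in which every binder (hence every bound variable) is decorated by a priority, an odd
one standing for `μ` and an even one for `ν`: a formula together with a priority assignment. -/
abbrev Ranked : Type := Fml ℕ

namespace Fml

/-- The variable `i` (counted from outside of the formula) occurs free. -/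
def FreeIn {κ : Type} : ℕ → Fml κ → Prop
  | _, pos _ => False
  | _, neg _ => False
  | i, var j => j = i
  | i, and φ ψ => FreeIn i φ ∨ FreeIn i ψ
  | i, or φ ψ => FreeIn i φ ∨ FreeIn i ψ
  | i, dia φ => FreeIn i φ
  | i, box φ => FreeIn i φ
  | i, fix _ φ => FreeIn (i + 1) φ
  | _, bot => False
  | _, top => False

/-- A sentence is a formula without free fixpoint variables. -/
def IsSentence {κ : Type} (φ : Fml κ) : Prop := ∀ i, ¬ FreeIn i φ

/-- All free occurrences of the variable `i` are in the scope of a modality. -/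
def GuardedVar {κ : Type} : ℕ → Fml κ → Prop
  | _, pos _ => True
  | _, neg _ => True
  | i, var j => j ≠ i
  | i, and φ ψ => GuardedVar i φ ∧ GuardedVar i ψ
  | i, or φ ψ => GuardedVar i φ ∧ GuardedVar i ψ
  | _, dia _ => True
  | _, box _ => True
  | i, fix _ φ => GuardedVar (i + 1) φ
  | _, bot => True
  | _, top => True

/-- Every bound variable is in the scope of a modality within its binding. -/
def Guarded {κ : Type} : Fml κ → Prop
  | pos _ => True
  | neg _ => True
  | var _ => True
  | and φ ψ => Guarded φ ∧ Guarded ψ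
  | or φ ψ => Guarded φ ∧ Guarded ψ
  | dia φ => Guarded φ
  | box φ => Guarded φ
  | fix _ φ => GuardedVar 0 φ ∧ Guarded φ
  | bot => True
  | top => True

/-- All labels of binders satisfy `p`. -/
def AllLabels {κ : Type} (p : κ → Prop) : Fml κ → Prop
  | pos _ => True
  | neg _ => True
  | var _ => True
  | and φ ψ => AllLabels p φ ∧ AllLabels p ψ
  | or φ ψ => AllLabels p φ ∧ AllLabels p ψ
  | dia φ => AllLabels p φ
  | box φ => AllLabels p φ
  | fix k φ => p k ∧ AllLabels p φ
  | bot => True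
  | top => True

/-- Forget the priorities: binders of odd priority are `μ`, those of even priority are `ν`. -/
def erase : Ranked → Formula
  | pos P => pos P
  | neg P => neg P
  | var i => var i
  | and φ ψ => and (erase φ) (erase ψ)
  | or φ ψ => or (erase φ) (erase ψ)
  | dia φ => dia (erase φ)
  | box φ => box (erase φ)
  | fix p φ => fix (if Even p then FP.nu else FP.mu) (erase φ)
  | bot => bot
  | top => top

/-- `Ω(X) ≥ Ω(Y)` whenever `X` is free in the formula binding `Y`; the list `ρ` holds the
priorities of the enclosing binders. -/
def OrderPreservingIn : List ℕ → Ranked → Prop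
  | _, pos _ => True
  | _, neg _ => True
  | _, var _ => True
  | ρ, and φ ψ => OrderPreservingIn ρ φ ∧ OrderPreservingIn ρ ψ
  | ρ, or φ ψ => OrderPreservingIn ρ φ ∧ OrderPreservingIn ρ ψ
  | ρ, dia φ => OrderPreservingIn ρ φ
  | ρ, box φ => OrderPreservingIn ρ φ
  | ρ, fix p φ =>
      (∀ i r, ρ[i]? = some r → FreeIn (i + 1) φ → p ≤ r) ∧ OrderPreservingIn (p :: ρ) φ
  | _, bot => True
  | _, top => True

/-- Order preserving priority assignments for sentences. A sentence has index `{m, …, q}` if it has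
an order preserving priority assignment with co-domain `{m, …, q}`. -/
def OrderPreserving (Ω : Ranked) : Prop := OrderPreservingIn [] Ω

end Fml

/-- `Ω` is a priority assignment for `Ψ` with co-domain `{m, …, q}` where `m ∈ {0, 1}`
(the co-domain is empty if `q < m`, which is possible for modal formulas only). -/
structure IsPriorityAssignment (m q : ℕ) (Ω : Ranked) (Ψ : Formula) : Prop where
  le_one : m ≤ 1
  erase_eq : Ω.erase = Ψ
  mem : Ω.AllLabels (fun p => m ≤ p ∧ p ≤ q)

/-! ### Structures and trees -/

/-- Rooted labelled transition systems. -/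
structure Struct where
  S : Type
  E : S → S → Prop
  r : S
  P : S → Set PropVar

namespace Struct

/-- The part of the structure that is reachable from `s`, rooted at `s`. -/
def sub (T : Struct) (s : T.S) : Struct where
  S := {t : T.S // Relation.ReflTransGen T.E s t}
  E t u := T.E t.1 u.1
  r := ⟨s, Relation.ReflTransGen.refl⟩
  P t := T.P t.1

/-- Isomorphism of rooted labelled structures. -/
def Iso (T U : Struct) : Prop :=
  ∃ e : T.S ≃ U.S, e T.r = U.r ∧ (∀ s t, T.E s t ↔ U.E (e s) (e t)) ∧ ∀ s, T.P s = U.P (e s)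

/-- Trees, labelled over a finite set of propositional variables. -/
structure IsTree (T : Struct) : Prop where
  root : ∀ s, ¬ T.E s T.r
  unique_pred : ∀ s t u, T.E s u → T.E t u → s = t
  reachable : ∀ s, Relation.ReflTransGen T.E T.r s
  finite_labels : ∃ A : Set PropVar, A.Finite ∧ ∀ s, T.P s ⊆ A

/-- Regular trees with finite (but unbounded) branching: there are only finitely many subtrees
up to isomorphism. -/
structure IsRegularTree (T : Struct) : Prop extends IsTree T where
  finite_branching : ∀ s, {t | T.E s t}.Finite
  regular : ∃ F : Set T.S, F.Finite ∧ ∀ s, ∃ t ∈ F, Iso (T.sub s) (T.sub t)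

/-- Finite paths from the root. -/
inductive Path (T : Struct) : T.S → Type
  | nil : Path T T.r
  | step {s t : T.S} (p : Path T s) (h : T.E s t) : Path T t

/-- The tree of finite paths from the root. -/
def unravel (T : Struct) : Struct where
  S := Σ s : T.S, Path T s
  E x y := ∃ h : T.E x.1 y.1, y.2 = Path.step x.2 h
  r := ⟨T.r, Path.nil⟩
  P x := T.P x.1

end Struct

/-! ### Parity games -/

/-- Parity game arenas: `odd v` says that `v` belongs to Odd, all other positions belong to Even. -/
structure ParityGame where
  V : Type
  odd : V → Prop
  edge : V → V → Prop
  init : V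
  prio : V → ℕ

namespace ParityGame

/-- A strategy for Even chooses a successor after every history (the list `h` of the earlier
positions and the current position `v`, which belongs to Even and has a successor). -/
def IsStrategy (G : ParityGame) (σ : List G.V → G.V → G.V) : Prop :=
  ∀ h v, ¬ G.odd v → (∃ w, G.edge v w) → G.edge v (σ h v)

/-- The sequence `π` is a play from the initial position at least up to time `k`, and until then
it agrees with the strategy `σ` for Even. -/
def Agrees (G : ParityGame) (σ : List G.V → G.V → G.V) (π : ℕ → G.V) (k : ℕ) : Prop :=
  π 0 = G.init ∧ ∀ n < k, G.edge (π n) (π (n + 1)) ∧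
    (¬ G.odd (π n) → π (n + 1) = σ ((List.range n).map π) (π n))

/-- The highest priority seen infinitely often is even. -/
def EvenDominant (G : ParityGame) (π : ℕ → G.V) : Prop :=
  ∃ p, Even p ∧ (∃ᶠ n in Filter.atTop, G.prio (π n) = p) ∧
    ∀ᶠ n in Filter.atTop, G.prio (π n) ≤ p

/-- Even has a winning strategy: every finite play that agrees with it and ends in a position
without successors ends in a position of Odd, and in every infinite play that agrees with it
the dominant priority is even. -/
def EvenWins (G : ParityGame) : Prop :=
  ∃ σ : List G.V → G.V → G.V, G.IsStrategy σ ∧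
    (∀ π k, G.Agrees σ π k → (∀ w, ¬ G.edge (π k) w) → G.odd (π k)) ∧
    (∀ π, (∀ k, G.Agrees σ π k) → G.EvenDominant π)

end ParityGame

/-! ### Parse trees with back edges and model-checking games -/

/-- A node of the parse tree of a sentence: a subformula, together with the enclosing binders
(priority and binding formula, innermost first). -/
structure Node where
  fml : Ranked
  env : List (ℕ × Ranked)
  deriving DecidableEq

namespace Node

/-- The root of the parse tree. -/
def root (Ω : Ranked) : Node := ⟨Ω, []⟩

/-- The immediate subformulas; the binding formula of `X` counts as an immediate subformula
of `X`. -/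
def im (a : Node) : List Node :=
  match a.fml with
  | .pos _ => []
  | .neg _ => []
  | .bot => []
  | .top => []
  | .var i =>
      match a.env.drop i with
      | [] => []
      | (p, β) :: ρ => [⟨β, (p, β) :: ρ⟩]
  | .and φ ψ => [⟨φ, a.env⟩, ⟨ψ, a.env⟩]
  | .or φ ψ => [⟨φ, a.env⟩, ⟨ψ, a.env⟩]
  | .dia φ => [⟨φ, a.env⟩]
  | .box φ => [⟨φ, a.env⟩]
  | .fix p φ => [⟨φ, (p, φ) :: a.env⟩]

/-- Formulas of the form `◇φ` or `□φ`. -/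
def isModal (a : Node) : Bool :=
  match a.fml with
  | .dia _ => true
  | .box _ => true
  | _ => false

/-- `Ω(X)` at a variable `X`, and the minimal priority `m` elsewhere. -/
def prio (m : ℕ) (a : Node) : ℕ :=
  match a.fml with
  | .var i =>
      match a.env.drop i with
      | [] => m
      | (p, _) :: _ => p
  | _ => m

/-- Whether the position consisting of the node `a` and a state with label `L` belongs to Odd. -/
def OddAt (L : Set PropVar) (a : Node) : Prop :=
  match a.fml with
  | .and _ _ => True
  | .box _ => True
  | .top => True
  | .pos P => P ∈ L
  | .neg P => P ∉ L
  | _ => False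

end Node

/-- The model-checking parity game arena `T × Ψ`, for the sentence `Ψ` with priority assignment
`Ω` whose co-domain has minimal element `m`. -/
def arena (T : Struct) (m : ℕ) (Ω : Ranked) : ParityGame where
  V := T.S × Node
  odd v := v.2.OddAt (T.P v.1)
  edge v w := w.2 ∈ v.2.im ∧ (if v.2.isModal then T.E v.1 w.1 else w.1 = v.1)
  init := (T.r, Node.root Ω)
  prio v := v.2.prio m

/-- `T ⊨ Ψ`: Even has a winning strategy in the model-checking game of `Ψ` on `T`, with respect
to an order preserving priority assignment. -/
def Sat (T : Struct) (Ψ : Formula) : Prop :=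
  ∃ (m q : ℕ) (Ω : Ranked), IsPriorityAssignment m q Ω Ψ ∧ Ω.OrderPreserving ∧
    (arena T m Ω).EvenWins

/-- The tree `T × Ψ` encoding the model-checking game: a position of Even (of Odd) of priority `i`
is labelled by `E i` (by `O i`), and modal positions are also labelled by `M`. -/
def gameTree (T : Struct) (m : ℕ) (Ω : Ranked) : Struct :=
  Struct.unravel
    { S := (arena T m Ω).V
      E := (arena T m Ω).edge
      r := (arena T m Ω).init
      P := fun v => {Q | (Q = .E ((arena T m Ω).prio v) ∧ ¬ (arena T m Ω).odd v) ∨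
        (Q = .O ((arena T m Ω).prio v) ∧ (arena T m Ω).odd v) ∨
        (Q = .M ∧ v.2.isModal = true)} }

/-- `Φ` interprets the sentence `Ψ` with priority assignment `Ω` and minimal priority `m`. -/
def Interprets (Φ Ψ : Formula) (m : ℕ) (Ω : Ranked) : Prop :=
  ∀ T : Struct, T.IsRegularTree → (Sat T Ψ ↔ Sat (gameTree T m Ω) Φ)

/-- Equivalence of sentences. -/
def Equivalent (Φ Ψ : Formula) : Prop :=
  ∀ T : Struct, T.IsRegularTree → (Sat T Φ ↔ Sat T Ψ)

/-! ### The product of two formulas -/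

namespace Product

/-- Finite conjunctions. -/
def conj : List Ranked → Ranked
  | [] => .top
  | [φ] => φ
  | φ :: ψ :: l => .and φ (conj (ψ :: l))

/-- Finite disjunctions. -/
def disj : List Ranked → Ranked
  | [] => .bot
  | [φ] => φ
  | φ :: ψ :: l => .or φ (disj (ψ :: l))

/-- The truth value `b` as a formula. -/
def ofBool (b : Bool) : Ranked := if b then .top else .bot

/-- The complement of a literal or constant (other formulas are not changed). -/
def compl : Ranked → Ranked
  | .pos P => .neg P
  | .neg P => .pos P
  | .top => .bot
  | .bot => .top
  | φ => φ

/-- The product `φ × P` of a node with a propositional variable: it expresses at a state `s` that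
the position `(s, φ)` is labelled by `P`. Only at literals does this depend on `s`. -/
def atom (m : ℕ) (a : Node) (P : PropVar) : Ranked :=
  match a.fml with
  | .pos Q => if P = .E m then .neg Q else if P = .O m then .pos Q else .bot
  | .neg Q => if P = .E m then .pos Q else if P = .O m then .neg Q else .bot
  | .and _ _ => ofBool (P = .O m)
  | .or _ _ => ofBool (P = .E m)
  | .box _ => ofBool (P = .O m ∨ P = .M)
  | .dia _ => ofBool (P = .E m ∨ P = .M)
  | .top => ofBool (P = .O m)
  | .bot => ofBool (P = .E m)
  | .fix _ _ => ofBool (P = .E m)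
  | .var _ => ofBool (P = .E (a.prio m))

/-- The priority of the variable whose binding formula is the node `x`. -/
def rank (x : Node) : ℕ :=
  match x.env with
  | [] => 0
  | (p, _) :: _ => p

/-- The list `st` holds the currently open binders `W_{φ×X}`, innermost first, as pairs of the node
`φ` and the binding formula of `X`. The result is the index of the innermost open binder
`W_{a×x}`, unless there is none or a binder `W_{φ'×Z}` with `Ω(Z) > Ω(X)` is open inside it. -/
def lookup (a x : Node) : List (Node × Node) → Option ℕ
  | [] => none
  | e :: st =>
      if e = (a, x) then some 0
      else if rank x < rank e.2 then none
      else (lookup a x st).map (· + 1)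

/-- The computation of the product `a × b` of a node `a` of `Ψ` and a node `b` of `Win`, where `st`
holds the open binders and `m` is the minimal priority for `Ψ`. The computation is cut off
(with result `none`) at recursion depth `fuel`. A fresh variable `W_{φ×X}` has the priority
of `X`. -/
def run (m : ℕ) : (fuel : ℕ) → (st : List (Node × Node)) → (a b : Node) → Option Ranked
  | 0, _, _, _ => none
  | fuel + 1, st, a, b =>
      match b.fml with
      | .pos P => some (atom m a P)
      | .neg P => some (compl (atom m a P))
      | .bot => some .bot
      | .top => some .top
      | .and ψ ψ' => do
          let x ← run m fuel st a ⟨ψ, b.env⟩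
          let y ← run m fuel st a ⟨ψ', b.env⟩
          return .and x y
      | .or ψ ψ' => do
          let x ← run m fuel st a ⟨ψ, b.env⟩
          let y ← run m fuel st a ⟨ψ', b.env⟩
          return .or x y
      | .box ψ => do
          let l ← a.im.mapM (fun a' => run m fuel st a' ⟨ψ, b.env⟩)
          return if a.isModal then .box (conj l) else conj l
      | .dia ψ => do
          let l ← a.im.mapM (fun a' => run m fuel st a' ⟨ψ, b.env⟩)
          return if a.isModal then .dia (disj l) else disj l
      | .var i =>
          match b.env.drop i with
          | [] => some .bot
          | (p, β) :: ρ =>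
              match lookup a ⟨β, (p, β) :: ρ⟩ st with
              | some j => some (.var j)
              | none => do
                  let x ← run m fuel ((a, ⟨β, (p, β) :: ρ⟩) :: st) a ⟨β, (p, β) :: ρ⟩
                  return .fix p x
      | .fix p β => do
          let x ← run m fuel ((a, ⟨β, (p, β) :: b.env⟩) :: st) a ⟨β, (p, β) :: b.env⟩
          return .fix p x

end Product

/-- The computation of the product of `Ψ` (with priority assignment `ΩΨ` and minimal priority `m`)
and `Win` (with priority assignment `ΩWin`) terminates, and the result is the formula `Ψ × Win`
with the priority assignment `Ω`. -/
def ProductHaltsWith (m : ℕ) (ΩΨ ΩWin Ω : Ranked) : Prop :=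
  ∃ N, ∀ fuel ≥ N, Product.run m fuel [] (Node.root ΩΨ) (Node.root ΩWin) = some Ω

end LMu

/-! Let `Φ` be the product. Since `Win` interprets `Ψ`, it suffices that Even wins the game of `Win`
on the tree `T × Ψ` if and only if Even wins the game of `Φ` on `T`. A position of the first game
consists of a position `(s, φ)` of `T × Ψ` and a subformula `ψ` of `Win`; it corresponds to `(s, φ ×
ψ)` in the second. A modality of `Win` moves along an edge of `T × Ψ`: this is a move in `T` if `φ`
is modal and a choice of an immediate subformula otherwise, and `φ × ψ` offers the same moves to the
same player. The one mismatch is a non-modal `φ` with exactly one immediate subformula, where `φ ×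
◇ψ` and `φ × □ψ` have no node of their own, so that `Φ` pauses for a move. The games are therefore
bisimilar up to stuttering (`Rel.moves`, `Rel.oddAt`), and winning strategies transfer in both
directions along a `StutterBisim`.

Priorities do not agree position by position, because the product may open a new binder where `Win`
unfolds a variable, and only variables carry their priority in the game. What agrees is `Node.lead`,
which counts binders too. By order preservation this is enough: every infinite path through a
sentence has a topmost variable that is unfolded infinitely often, and from some point on neither a
variable nor a binder of higher priority is met (`Node.exists_top`). So the leads alone decide the
winner.

The same lemma shows that the choice of an order preserving assignment is irrelevant
(`evenWins_arena_congr`), and that the computation terminates (`acc_calls`): an infinite computation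
would unfold the topmost variable `X` of `Win` infinitely often, by the pigeonhole principle twice
against the same `φ`, with no binder of higher priority opened in between, so that the second time
`W_{φ×X}` would have been available. The result is order preserving because the search for an open
binder never passes one of higher priority. It is guarded because the pair of distances of `φ` and
`ψ` from their next modalities decreases lexicographically as long as the product emits no modality.
-/

namespace LMu

open Filter

/-! ### Strategies with memory and stuttering bisimulations -/

namespace ParityGame

/-- Infinite plays from the initial position. -/
def IsPlay (G : ParityGame) (π : ℕ → G.V) : Prop :=
  π 0 = G.init ∧ ∀ n, G.edge (π n) (π (n + 1))

/-- A nondeterministic winning strategy for Even with memory. -/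
structure Unfolding (G : ParityGame) where
  M : Type
  start : M
  step : M → M → Prop
  val : M → G.V
  val_start : val start = G.init
  edge : ∀ {a b}, step a b → G.edge (val a) (val b)
  exists_odd : ∀ {a w}, G.odd (val a) → G.edge (val a) w → ∃ b, step a b ∧ val b = w
  exists_even : ∀ {a}, ¬ G.odd (val a) → ∃ b, step a b
  win : ∀ c : ℕ → M, c 0 = start → (∀ n, step (c n) (c (n + 1))) →
    G.EvenDominant fun n => val (c n)

/-- The histories that agree with a strategy. -/
inductive Consistent (G : ParityGame) (σ : List G.V → G.V → G.V) : List G.V → G.V → Prop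
  | init : Consistent G σ [] G.init
  | step {h v w} : Consistent G σ h v → G.edge v w → (¬ G.odd v → w = σ h v) →
      Consistent G σ (h ++ [v]) w

theorem Agrees.congr {G : ParityGame} {σ : List G.V → G.V → G.V} {π π' : ℕ → G.V} {k : ℕ}
    (h : G.Agrees σ π k) (e : ∀ n ≤ k, π' n = π n) : G.Agrees σ π' k := by
  refine ⟨(e 0 (Nat.zero_le _)).trans h.1, fun n hn => ?_⟩
  have hl : (List.range n).map π' = (List.range n).map π :=
    List.map_congr_left fun i hi => e i (by have := List.mem_range.1 hi; omega)
  rw [e n hn.le, e (n + 1) hn, hl]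
  exact h.2 n hn

/-- `EvenWins` describes finite plays by sequences that are arbitrary after time `k`; this puts a
history into that form, with one `Function.update` for each move. -/
theorem Consistent.exists_agrees {G : ParityGame} {σ : List G.V → G.V → G.V} {h : List G.V}
    {v : G.V} (H : Consistent G σ h v) :
    ∃ π k, G.Agrees σ π k ∧ (List.range k).map π = h ∧ π k = v := by
  induction H with
  | init => exact ⟨fun _ => G.init, 0, ⟨rfl, by simp⟩, rfl, rfl⟩
  | @step h v w _ he hs ih =>
    obtain ⟨π, k, ha, rfl, rfl⟩ := ih
    have e : ∀ n ≤ k, Function.update π (k + 1) w n = π n := fun n hn =>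
      Function.update_of_ne (by omega) _ _
    have hl : (List.range k).map (Function.update π (k + 1) w) = (List.range k).map π :=
      List.map_congr_left fun i hi => e i (List.mem_range.1 hi).le
    have ha' := ha.congr e
    refine ⟨Function.update π (k + 1) w, k + 1, ⟨ha'.1, fun n hn => ?_⟩, ?_, by simp⟩
    · rcases Nat.lt_succ_iff_lt_or_eq.1 hn with hn | rfl
      · exact ha'.2 n hn
      · rw [hl, e _ le_rfl, Function.update_self]
        exact ⟨he, hs⟩
    · rw [List.range_succ, List.map_append, hl, List.map_singleton, e k le_rfl]

/-- The memory is the consistent history itself. Even never gets stuck because of the clause of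
`EvenWins` about finite plays. -/
theorem EvenWins.nonempty_unfolding {G : ParityGame} (H : G.EvenWins) : Nonempty G.Unfolding := by
  obtain ⟨σ, hσ, hfin, hinf⟩ := H
  refine ⟨{ M := {x : List G.V × G.V // Consistent G σ x.1 x.2}
            start := ⟨([], G.init), .init⟩
            step := fun x y => y.1.1 = x.1.1 ++ [x.1.2] ∧ G.edge x.1.2 y.1.2 ∧
              (¬ G.odd x.1.2 → y.1.2 = σ x.1.1 x.1.2)
            val := fun x => x.1.2
            val_start := rfl
            edge := fun h => h.2.1
            exists_odd := ?_
            exists_even := ?_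
            win := ?_ }⟩
  · rintro ⟨⟨h, v⟩, hv⟩ w ho he
    exact ⟨⟨(h ++ [v], w), hv.step he fun hn => absurd ho hn⟩,
      ⟨rfl, he, fun hn => absurd ho hn⟩, rfl⟩
  · rintro ⟨⟨h, v⟩, hv⟩ ho
    have hex : ∃ w, G.edge v w := by
      by_contra! hne
      obtain ⟨π, k, ha, _, rfl⟩ := hv.exists_agrees
      exact ho (hfin π k ha hne)
    have he := hσ h v ho hex
    exact ⟨⟨(h ++ [v], σ h v), hv.step he fun _ => rfl⟩, rfl, he, fun _ => rfl⟩
  · intro c h0 hc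
    have hl : ∀ n, (c n).1.1 = (List.range n).map fun n => (c n).1.2 := by
      intro n
      induction n with
      | zero => simp [h0]
      | succ n ih => rw [(hc n).1, ih, List.range_succ, List.map_append, List.map_singleton]
    refine hinf _ fun k => ⟨by simp [h0], fun n _ => ⟨(hc n).2.1, fun ho => ?_⟩⟩
    rw [← hl n]
    exact (hc n).2.2 ho

/-- A nondeterministic winning strategy for Even with memory, where the memory may be changed
a bounded number of times between two moves. -/
structure Tableau (G : ParityGame) where
  M : Type
  start : M
  step : M → M → Prop
  val : M → G.V
  idle : M → Prop
  size : M → ℕ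
  val_start : val start = G.init
  val_idle : ∀ {a b}, idle a → step a b → val b = val a
  size_idle : ∀ {a b}, idle a → step a b → size b < size a
  exists_idle : ∀ {a}, idle a → ∃ b, step a b
  edge : ∀ {a b}, ¬ idle a → step a b → G.edge (val a) (val b)
  exists_odd : ∀ {a w}, ¬ idle a → G.odd (val a) → G.edge (val a) w → ∃ b, step a b ∧ val b = w
  exists_even : ∀ {a}, ¬ idle a → ¬ G.odd (val a) → ∃ b, step a b
  win : ∀ (c : ℕ → M) (π : ℕ → G.V) (κ : ℕ → ℕ), c 0 = start → (∀ n, step (c n) (c (n + 1))) →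
    G.IsPlay π → κ 0 = 0 → (∀ n, idle (c n) → κ (n + 1) = κ n) →
    (∀ n, ¬ idle (c n) → κ (n + 1) = κ n + 1) → (∀ n, val (c n) = π (κ n)) → G.EvenDominant π

/-! ### From tableaux to strategies -/

namespace Tableau

variable {G : ParityGame} (A : G.Tableau)

open Classical in
/-- A successor of `a` with value `w`. -/
noncomputable def next (a : A.M) (w : G.V) : A.M :=
  if h : ∃ b, A.step a b ∧ A.val b = w then h.choose else a

theorem next_spec {a : A.M} {w : G.V} (h : ∃ b, A.step a b ∧ A.val b = w) :
    A.step a (A.next a w) ∧ A.val (A.next a w) = w := by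
  rw [next, dif_pos h]
  exact h.choose_spec

theorem next_idle {a : A.M} (h : A.idle a) :
    A.step a (A.next a (A.val a)) ∧ A.val (A.next a (A.val a)) = A.val a :=
  A.next_spec ((A.exists_idle h).imp fun _ hb => ⟨hb, A.val_idle h hb⟩)

open Classical in
/-- The first memory state that is not idle. -/
noncomputable def settle (a : A.M) : A.M :=
  if _h : A.idle a then settle (A.next a (A.val a)) else a
termination_by A.size a
decreasing_by exact A.size_idle _h (A.next_idle _h).1

theorem settle_of_idle {a : A.M} (h : A.idle a) :
    A.settle a = A.settle (A.next a (A.val a)) := by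
  rw [settle, dif_pos h]

theorem settle_of_not_idle {a : A.M} (h : ¬ A.idle a) : A.settle a = a := by
  rw [settle, dif_neg h]

theorem settle_spec (a : A.M) : ¬ A.idle (A.settle a) ∧ A.val (A.settle a) = A.val a := by
  induction hn : A.size a using Nat.strong_induction_on generalizing a with
  | _ n ih =>
    by_cases h : A.idle a
    · have := ih _ (hn ▸ A.size_idle h (A.next_idle h).1) _ rfl
      rwa [(A.next_idle h).2, ← A.settle_of_idle h] at this
    · rw [A.settle_of_not_idle h]
      exact ⟨h, rfl⟩

open Classical in
/-- The value of some successor of `a`. -/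
noncomputable def pick (a : A.M) : G.V :=
  if h : ∃ b, A.step a b then A.val h.choose else A.val a

theorem pick_spec {a : A.M} (h : ∃ b, A.step a b) : ∃ b, A.step a b ∧ A.val b = A.pick a := by
  rw [pick, dif_pos h]
  exact ⟨_, h.choose_spec, rfl⟩

/-- The memory state after `n` moves of the play `π`. -/
noncomputable def mem (π : ℕ → G.V) : ℕ → A.M
  | 0 => A.settle A.start
  | n + 1 => A.settle (A.next (mem π n) (π (n + 1)))

theorem mem_congr {π π' : ℕ → G.V} {k : ℕ} (e : ∀ n ≤ k, π n = π' n) :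
    A.mem π k = A.mem π' k := by
  induction k with
  | zero => rfl
  | succ k ih => rw [mem, mem, e (k + 1) le_rfl, ih fun n hn => e n (by omega)]

open Classical in
/-- The strategy given by a tableau. -/
noncomputable def strategy (h : List G.V) (v : G.V) : G.V :=
  -- Only the entries of `h ++ [v]` up to index `h.length` are read, so the default value `v` is
  -- irrelevant. The fallback to an arbitrary legal move matters only for histories that do not
  -- arise from the strategy.
  if G.edge v (A.pick (A.mem (fun n => (h ++ [v]).getD n v) h.length)) then
    A.pick (A.mem (fun n => (h ++ [v]).getD n v) h.length)
  else if h : ∃ w, G.edge v w then h.choose else v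

theorem isStrategy_strategy : G.IsStrategy A.strategy := by
  intro h v _ hv
  unfold strategy
  split_ifs with h1
  · exact h1
  · exact hv.choose_spec

theorem strategy_map (π : ℕ → G.V) (k : ℕ) (he : G.edge (π k) (A.pick (A.mem π k))) :
    A.strategy ((List.range k).map π) (π k) = A.pick (A.mem π k) := by
  have : A.mem (fun n => ((List.range k).map π ++ [π k]).getD n (π k))
      ((List.range k).map π).length = A.mem π k := by
    rw [List.length_map, List.length_range]
    refine A.mem_congr fun n hn => ?_
    have : (List.range k).map π ++ [π k] = (List.range (k + 1)).map π := by
      rw [List.range_succ, List.map_append, List.map_singleton]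
    rw [this, List.getD_eq_getElem _ _ (by simp; omega)]
    simp
  rw [strategy, this, if_pos he]

/-- Along a play that agrees with the strategy the memory follows the play: a move of Even is the
value of some successor by the choice of `pick`, a move of Odd by `exists_odd`. -/
theorem val_mem {π : ℕ → G.V} {k : ℕ} (h : G.Agrees A.strategy π k) :
    ¬ A.idle (A.mem π k) ∧ A.val (A.mem π k) = π k := by
  induction k with
  | zero =>
    have := A.settle_spec A.start
    rw [A.val_start, ← h.1] at this
    exact this
  | succ k ih =>
    obtain ⟨hi, hv⟩ := ih ⟨h.1, fun n hn => h.2 n (by omega)⟩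
    obtain ⟨he, hs⟩ := h.2 k (by omega)
    have : ∃ b, A.step (A.mem π k) b ∧ A.val b = π (k + 1) := by
      by_cases ho : G.odd (π k)
      · exact A.exists_odd hi (hv ▸ ho) (hv ▸ he)
      · obtain ⟨b, hb, hb'⟩ := A.pick_spec (A.exists_even hi (hv ▸ ho))
        have hp := A.edge hi hb
        rw [hv, hb'] at hp
        rw [hs ho, A.strategy_map π k hp]
        exact ⟨b, hb, hb'⟩
    have h2 := A.settle_spec (A.next (A.mem π k) (π (k + 1)))
    rw [(A.next_spec this).2] at h2
    exact h2

theorem step_next_mem {π : ℕ → G.V} {k : ℕ} (h : G.Agrees A.strategy π (k + 1)) :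
    A.step (A.mem π k) (A.next (A.mem π k) (π (k + 1))) ∧
      A.val (A.next (A.mem π k) (π (k + 1))) = π (k + 1) := by
  obtain ⟨hi, hv⟩ := A.val_mem ⟨h.1, fun n (hn : n < k) => h.2 n (by omega)⟩
  obtain ⟨he, hs⟩ := h.2 k (by omega)
  apply A.next_spec
  by_cases ho : G.odd (π k)
  · exact A.exists_odd hi (hv ▸ ho) (hv ▸ he)
  · obtain ⟨b, hb, hb'⟩ := A.pick_spec (A.exists_even hi (hv ▸ ho))
    have hp := A.edge hi hb
    rw [hv, hb'] at hp
    rw [hs ho, A.strategy_map π k hp]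
    exact ⟨b, hb, hb'⟩

open Classical in
/-- The sequence of all memory states, with the number of moves made so far. -/
noncomputable def trace (π : ℕ → G.V) : ℕ → A.M × ℕ
  | 0 => (A.start, 0)
  | n + 1 =>
    if A.idle (trace π n).1 then (A.next (trace π n).1 (A.val (trace π n).1), (trace π n).2)
    else (A.next (trace π n).1 (π ((trace π n).2 + 1)), (trace π n).2 + 1)

theorem trace_idle {π : ℕ → G.V} {n : ℕ} (h : A.idle (A.trace π n).1) :
    A.trace π (n + 1) =
      (A.next (A.trace π n).1 (A.val (A.trace π n).1), (A.trace π n).2) := by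
  rw [trace, if_pos h]

theorem trace_not_idle {π : ℕ → G.V} {n : ℕ} (h : ¬ A.idle (A.trace π n).1) :
    A.trace π (n + 1) =
      (A.next (A.trace π n).1 (π ((A.trace π n).2 + 1)), (A.trace π n).2 + 1) := by
  rw [trace, if_neg h]

theorem evenWins {G : ParityGame} (A : G.Tableau) : G.EvenWins := by
  refine ⟨A.strategy, A.isStrategy_strategy, fun π k h hne => ?_, fun π h => ?_⟩
  · obtain ⟨hi, hv⟩ := A.val_mem h
    by_contra ho
    obtain ⟨b, hb⟩ := A.exists_even hi (hv ▸ ho)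
    exact hne _ (hv ▸ A.edge hi hb)
  -- Settling absorbs the idle steps, so the full trace and `mem` agree after equally many moves.
  -- Hence the trace is a run to which `A.win` applies.
  · have hset : ∀ n, A.settle (A.trace π n).1 = A.mem π (A.trace π n).2 := by
      intro n
      induction n with
      | zero => rfl
      | succ n ih =>
        by_cases hi : A.idle (A.trace π n).1
        · rw [A.trace_idle hi, ← ih, A.settle_of_idle hi]
        · rw [A.settle_of_not_idle hi] at ih
          rw [A.trace_not_idle hi, mem, ih]
    have hmem : ∀ n, ¬ A.idle (A.trace π n).1 → (A.trace π n).1 = A.mem π (A.trace π n).2 :=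
      fun n hi => by rw [← hset, A.settle_of_not_idle hi]
    refine A.win (fun n => (A.trace π n).1) π (fun n => (A.trace π n).2) rfl (fun n => ?_)
      ⟨(h 0).1, fun n => ((h (n + 1)).2 n (by omega)).1⟩ rfl (fun n hi => ?_) (fun n hi => ?_)
      fun n => ?_
    · by_cases hi : A.idle (A.trace π n).1
      · rw [A.trace_idle hi]
        exact (A.next_idle hi).1
      · rw [A.trace_not_idle hi, hmem n hi]
        exact (A.step_next_mem (h _)).1
    · simp only [A.trace_idle hi]
    · simp only [A.trace_not_idle hi]
    · show A.val (A.trace π n).1 = π (A.trace π n).2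
      rw [← (A.settle_spec _).2, hset]
      exact (A.val_mem (h _)).2

end Tableau

/-- A bisimulation between games where `G` may make additional forced moves at idle positions. -/
structure StutterBisim (G H : ParityGame) where
  R : G.V → H.V → Prop
  idle : G.V → Prop
  size : G.V → ℕ
  init : R G.init H.init
  size_idle : ∀ {u u'}, idle u → G.edge u u' → size u' < size u
  rel_idle : ∀ {u u' v}, R u v → idle u → G.edge u u' → R u' v
  exists_idle : ∀ {u v}, R u v → idle u → ∃ u', G.edge u u'
  odd_iff : ∀ {u v}, R u v → ¬ idle u → (G.odd u ↔ H.odd v)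
  forth : ∀ {u u' v}, R u v → ¬ idle u → G.edge u u' → ∃ v', H.edge v v' ∧ R u' v'
  back : ∀ {u v v'}, R u v → ¬ idle u → H.edge v v' → ∃ u', G.edge u u' ∧ R u' v'
  dominant_iff : ∀ (π : ℕ → G.V) (π' : ℕ → H.V) (κ : ℕ → ℕ), G.IsPlay π → H.IsPlay π' → κ 0 = 0 →
    (∀ n, idle (π n) → κ (n + 1) = κ n) → (∀ n, ¬ idle (π n) → κ (n + 1) = κ n + 1) →
    (∀ n, R (π n) (π' (κ n))) → (G.EvenDominant π ↔ H.EvenDominant π')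

/-! ### Transfer of winning strategies along stuttering bisimulations -/

namespace StutterBisim

variable {G H : ParityGame} (B : StutterBisim G H)

theorem exists_not_idle {π : ℕ → G.V} (h : ∀ n, G.edge (π n) (π (n + 1))) (N : ℕ) :
    ∃ n ≥ N, ¬ B.idle (π n) := by
  induction hs : B.size (π N) using Nat.strong_induction_on generalizing N with
  | _ s ih =>
    by_cases hi : B.idle (π N)
    · obtain ⟨n, hn, h'⟩ := ih _ (hs ▸ B.size_idle hi (h N)) (N + 1) rfl
      exact ⟨n, by omega, h'⟩
    · exact ⟨N, le_rfl, hi⟩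

/-- The memory pairs a state of the strategy for `G` with a related position of `H`. While `G` is at
an idle position its strategy moves on and `H` stands still; these are the idle steps of the
tableau. -/
theorem evenWins_right (B : StutterBisim G H) (hG : G.EvenWins) : H.EvenWins := by
  obtain ⟨U⟩ := hG.nonempty_unfolding
  refine Tableau.evenWins
    { M := {x : U.M × H.V // B.R (U.val x.1) x.2}
      start := ⟨(U.start, H.init), by simpa [U.val_start] using B.init⟩
      step := fun x y => U.step x.1.1 y.1.1 ∧ (B.idle (U.val x.1.1) → y.1.2 = x.1.2) ∧
        (¬ B.idle (U.val x.1.1) → H.edge x.1.2 y.1.2)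
      val := fun x => x.1.2
      idle := fun x => B.idle (U.val x.1.1)
      size := fun x => B.size (U.val x.1.1)
      val_start := rfl
      val_idle := fun hi h => h.2.1 hi
      size_idle := fun hi h => B.size_idle hi (U.edge h.1)
      edge := fun hi h => h.2.2 hi
      exists_idle := ?_
      exists_odd := ?_
      exists_even := ?_
      win := ?_ }
  · rintro ⟨⟨μ, v⟩, hR⟩ (hi : B.idle (U.val μ))
    have : ∃ b, U.step μ b := by
      by_cases ho : G.odd (U.val μ)
      · obtain ⟨u', hu⟩ := B.exists_idle hR hi
        exact (U.exists_odd ho hu).imp fun _ h => h.1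
      · exact U.exists_even ho
    obtain ⟨b, hb⟩ := this
    exact ⟨⟨(b, v), B.rel_idle hR hi (U.edge hb)⟩, hb, fun _ => rfl, fun h => absurd hi h⟩
  · rintro ⟨⟨μ, v⟩, hR⟩ w (hi : ¬ B.idle (U.val μ)) (ho : H.odd v) (he : H.edge v w)
    obtain ⟨u', hu, hR'⟩ := B.back hR hi he
    obtain ⟨b, hb, rfl⟩ := U.exists_odd ((B.odd_iff hR hi).2 ho) hu
    exact ⟨⟨(b, w), hR'⟩, ⟨hb, fun h => absurd h hi, fun _ => he⟩, rfl⟩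
  · rintro ⟨⟨μ, v⟩, hR⟩ (hi : ¬ B.idle (U.val μ)) (ho : ¬ H.odd v)
    obtain ⟨b, hb⟩ := U.exists_even (mt (B.odd_iff hR hi).1 ho)
    obtain ⟨v', hv, hR'⟩ := B.forth hR hi (U.edge hb)
    exact ⟨⟨(b, v'), hR'⟩, hb, fun h => absurd h hi, fun _ => hv⟩
  · intro c π κ h0 hc hπ hκ h1 h2 hv
    have hs : ∀ n, U.step (c n).1.1 (c (n + 1)).1.1 := fun n => (hc n).1
    have h0' : (c 0).1.1 = U.start := by rw [h0]
    refine (B.dominant_iff (fun n => U.val (c n).1.1) π κ ⟨?_, fun n => U.edge (hs n)⟩ hπ hκ h1 h2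
      fun n => ?_).1 (U.win (fun n => (c n).1.1) h0' hs)
    · show U.val (c 0).1.1 = _
      rw [h0', U.val_start]
    · rw [← hv n]
      exact (c n).2

/-- Here `G` sets the pace: at its idle positions the memory for `H` is frozen and Even may take any
move. So no tableau state is idle. -/
theorem evenWins_left (B : StutterBisim G H) (hH : H.EvenWins) : G.EvenWins := by
  classical
  obtain ⟨U⟩ := hH.nonempty_unfolding
  refine Tableau.evenWins
    { M := {x : G.V × U.M // B.R x.1 (U.val x.2)}
      start := ⟨(G.init, U.start), by simpa [U.val_start] using B.init⟩
      step := fun x y => G.edge x.1.1 y.1.1 ∧ (B.idle x.1.1 → y.1.2 = x.1.2) ∧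
        (¬ B.idle x.1.1 → U.step x.1.2 y.1.2)
      val := fun x => x.1.1
      idle := fun _ => False
      size := fun _ => 0
      val_start := rfl
      val_idle := False.elim
      size_idle := False.elim
      edge := fun _ h => h.1
      exists_idle := False.elim
      exists_odd := ?_
      exists_even := ?_
      win := ?_ }
  · rintro ⟨⟨u, μ⟩, hR⟩ w - (ho : G.odd u) (he : G.edge u w)
    by_cases hi : B.idle u
    · exact ⟨⟨(w, μ), B.rel_idle hR hi he⟩, ⟨he, fun _ => rfl, fun h => absurd hi h⟩, rfl⟩
    · obtain ⟨v', hv, hR'⟩ := B.forth hR hi he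
      obtain ⟨b, hb, rfl⟩ := U.exists_odd ((B.odd_iff hR hi).1 ho) hv
      exact ⟨⟨(w, b), hR'⟩, ⟨he, fun h => absurd h hi, fun _ => hb⟩, rfl⟩
  · rintro ⟨⟨u, μ⟩, hR⟩ - (ho : ¬ G.odd u)
    by_cases hi : B.idle u
    · obtain ⟨u', hu⟩ := B.exists_idle hR hi
      exact ⟨⟨(u', μ), B.rel_idle hR hi hu⟩, hu, fun _ => rfl, fun h => absurd hi h⟩
    · obtain ⟨b, hb⟩ := U.exists_even (mt (B.odd_iff hR hi).2 ho)
      obtain ⟨u', hu, hR'⟩ := B.back hR hi (U.edge hb)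
      exact ⟨⟨(u', b), hR'⟩, hu, fun h => absurd h hi, fun _ => hb⟩
  · intro c π κ h0 hc hπ hκ _ h2 hv
    have hκ' : ∀ n, κ n = n := fun n => by
      induction n with
      | zero => exact hκ
      | succ n ih => rw [h2 n not_false, ih]
    obtain rfl : π = fun n => (c n).1.1 := funext fun n => by rw [hv n, hκ' n]
    -- The winning condition of `U` needs a play of `H` without pauses. The non-idle times are
    -- infinitely many, so `Nat.nth` enumerates them and `Nat.count` is the stutter counter; the
    -- memory for `H` changes only at these times.
    have hinf : (Set.ofPred fun n => ¬ B.idle (c n).1.1).Infinite :=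
      Set.infinite_of_not_bddAbove fun ⟨N, hN⟩ => by
        obtain ⟨n, hn, hi⟩ := B.exists_not_idle hπ.2 (N + 1)
        have := hN hi
        omega
    set p : ℕ → Prop := fun n => ¬ B.idle (c n).1.1 with hp
    have hconst : ∀ n k, Nat.count p (n + k) = Nat.count p n → (c (n + k)).1.2 = (c n).1.2 := by
      intro n k
      induction k with
      | zero => intro; rfl
      | succ k ih =>
        intro hk
        have hm1 := Nat.count_monotone p (Nat.le_add_right n k)
        have hs := Nat.count_succ p (n + k)
        rw [← add_assoc] at hk ⊢
        split_ifs at hs with hpn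
        · omega
        · rw [(hc (n + k)).2.1 (not_not.1 hpn), ih (by omega)]
    have hconst' : ∀ n n', Nat.count p n = Nat.count p n' → (c n).1.2 = (c n').1.2 := by
      intro n n' h
      rcases le_total n n' with hn | hn
      · obtain ⟨k, rfl⟩ := Nat.exists_eq_add_of_le hn
        exact (hconst n k h.symm).symm
      · obtain ⟨k, rfl⟩ := Nat.exists_eq_add_of_le hn
        exact hconst n' k h
    have hcn : ∀ j, Nat.count p (Nat.nth p j) = j := Nat.count_nth_of_infinite hinf
    have hpn : ∀ j, p (Nat.nth p j) := Nat.nth_mem_of_infinite hinf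
    have hstep : ∀ j, U.step (c (Nat.nth p j)).1.2 (c (Nat.nth p (j + 1))).1.2 := by
      intro j
      rw [hconst' (Nat.nth p (j + 1)) (Nat.nth p j + 1)]
      · exact (hc _).2.2 (hpn j)
      · rw [hcn, Nat.count_succ, if_pos (hpn j), hcn]
    have hstart : (c (Nat.nth p 0)).1.2 = U.start := by
      rw [hconst' (Nat.nth p 0) 0 (by rw [hcn, Nat.count_zero]), h0]
    refine (B.dominant_iff _ (fun j => U.val (c (Nat.nth p j)).1.2) (Nat.count p) hπ
      ⟨by simp only [hstart, U.val_start], fun j => U.edge (hstep j)⟩ (Nat.count_zero _)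
      (fun n hi => ?_) (fun n hi => ?_) fun n => ?_).2 (U.win _ hstart hstep)
    · rw [Nat.count_succ, if_neg (not_not.2 hi), add_zero]
    · rw [Nat.count_succ, if_pos hi]
    · rw [hconst' (Nat.nth p (Nat.count p n)) n (hcn _)]
      exact (c n).2

theorem evenWins_iff (B : StutterBisim G H) : G.EvenWins ↔ H.EvenWins := ⟨B.evenWins_right, B.evenWins_left⟩

end StutterBisim

end ParityGame


/-- The infinite pigeonhole principle. -/
theorem exists_frequently_eq {α : Type*} {S : Set α} (hS : S.Finite) {P : ℕ → Prop}
    (hP : ∃ᶠ n in atTop, P n) {f : ℕ → α} (hf : ∀ n, f n ∈ S) :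
    ∃ x ∈ S, ∃ᶠ n in atTop, P n ∧ f n = x := by
  by_contra! h
  refine hP (((eventually_all_finite hS).2 h).mono fun n hn hPn => ?_)
  exact hn _ (hf n) hPn rfl

/-! ### Paths in parse trees with back edges -/

namespace Node

/-- The priority of a variable or binder, and `0` at other nodes. -/
def lead (a : Node) : ℕ :=
  match a.fml with
  | .var i =>
      match a.env.drop i with
      | [] => 0
      | (p, _) :: _ => p
  | .fix p _ => p
  | _ => 0

/-- `a` is a variable, and `E` consists of its binder and the binders around it. -/
def Jumps (a : Node) (E : List (ℕ × Ranked)) : Prop :=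
  ∃ i, a.fml = .var i ∧ a.env.drop i = E

/-- Properties that are passed on to immediate subformulas, except from variables. -/
def Hereditary (Q : Node → Prop) : Prop :=
  ∀ a a', a' ∈ a.im → (∀ i, a.fml ≠ .var i) → Q a → Q a'

/-- The node and the binding formulas around it have the property `Q`. -/
def Inv (Q : Node → Prop) (a : Node) : Prop :=
  Q a ∧ ∀ p β ρ, (p, β) :: ρ <:+ a.env → Q ⟨β, (p, β) :: ρ⟩

theorem Inv.root {Q : Node → Prop} {Ω : Ranked} (h : Q (root Ω)) : Inv Q (root Ω) :=
  ⟨h, fun p β ρ hs => by simp [Node.root] at hs⟩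

theorem im_var {i : ℕ} {ρ : List (ℕ × Ranked)} {a' : Node} (h : a' ∈ im ⟨.var i, ρ⟩) :
    ∃ p β ρ', ρ.drop i = (p, β) :: ρ' ∧ a' = ⟨β, (p, β) :: ρ'⟩ := by
  simp only [im] at h
  split at h
  · simp at h
  · rename_i p β ρ' he
    exact ⟨p, β, ρ', he, by simpa using h⟩

theorem im_of_drop {i : ℕ} {ρ ρ' : List (ℕ × Ranked)} {p : ℕ} {β : Ranked}
    (h : ρ.drop i = (p, β) :: ρ') : im ⟨.var i, ρ⟩ = [⟨β, (p, β) :: ρ'⟩] := by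
  simp only [im, h]

theorem env_im {a a' : Node} (h : a' ∈ a.im) (hv : ∀ i, a.fml ≠ .var i) :
    a'.env = a.env ∨ ∃ p, a.fml = .fix p a'.fml ∧ a'.env = (p, a'.fml) :: a.env := by
  rcases a with ⟨φ, ρ⟩
  cases φ <;> simp only [im, List.mem_cons, List.not_mem_nil, or_false] at h
  case var i => exact absurd rfl (hv i)
  case and => rcases h with rfl | rfl <;> exact .inl rfl
  case or => rcases h with rfl | rfl <;> exact .inl rfl
  case fix p φ => subst h; exact .inr ⟨p, rfl, rfl⟩
  all_goals subst h; exact .inl rfl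

/-- A variable leads back to one of the binding formulas around it, and `Inv` includes these. So an
invariant has to be checked only for steps down into the formula. -/
theorem Inv.im {Q : Node → Prop} (hQ : Hereditary Q) {a a' : Node} (h : Inv Q a)
    (h' : a' ∈ a.im) : Inv Q a' := by
  by_cases hv : ∃ i, a.fml = .var i
  · obtain ⟨i, hi⟩ := hv
    rcases a with ⟨φ, ρ⟩
    obtain rfl : φ = .var i := hi
    obtain ⟨p, β, ρ', he, rfl⟩ := im_var h'
    have hs : (p, β) :: ρ' <:+ ρ := he ▸ List.drop_suffix i ρ
    exact ⟨h.2 _ _ _ hs, fun q γ τ ht => h.2 _ _ _ (ht.trans hs)⟩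
  · push Not at hv
    have hq := hQ a a' h' hv h.1
    refine ⟨hq, fun p β ρ hs => ?_⟩
    rcases env_im h' hv with he | ⟨q, _, he⟩
    · exact h.2 _ _ _ (he ▸ hs)
    · rw [he, List.suffix_cons_iff] at hs
      rcases hs with hs | hs
      · obtain ⟨h1, rfl⟩ := List.cons.inj hs
        obtain ⟨rfl, rfl⟩ := Prod.mk.inj h1
        rwa [← he]
      · exact h.2 _ _ _ hs

theorem Inv.path {Q : Node → Prop} (hQ : Hereditary Q) {a : ℕ → Node} (h : Inv Q (a 0))
    (ha : ∀ n, a (n + 1) ∈ (a n).im) (n : ℕ) : Inv Q (a n) := by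
  induction n with
  | zero => exact h
  | succ n ih => exact ih.im hQ (ha n)

theorem sizeOf_im {a a' : Node} (h : a' ∈ a.im) (hv : ∀ i, a.fml ≠ .var i) :
    sizeOf a'.fml < sizeOf a.fml := by
  rcases a with ⟨φ, ρ⟩
  cases φ <;> simp only [Node.im, List.mem_cons, List.not_mem_nil, or_false] at h
  case var i => exact absurd rfl (hv i)
  case and => rcases h with rfl | rfl <;> (simp only [Fml.and.sizeOf_spec]; omega)
  case or => rcases h with rfl | rfl <;> (simp only [Fml.or.sizeOf_spec]; omega)
  all_goals subst h; simp

/-- Every step that does not start at a variable shrinks the formula. -/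
theorem exists_jumps {a : ℕ → Node} (ha : ∀ n, a (n + 1) ∈ (a n).im) (N : ℕ) :
    ∃ n ≥ N, (a n).Jumps (a (n + 1)).env := by
  induction hs : sizeOf (a N).fml using Nat.strong_induction_on generalizing N with
  | _ s ih =>
    by_cases hv : ∃ i, (a N).fml = .var i
    · obtain ⟨i, hi⟩ := hv
      refine ⟨N, le_rfl, i, hi, ?_⟩
      have h := ha N
      generalize a N = x at hi h
      rcases x with ⟨φ, ρ⟩
      obtain rfl : φ = .var i := hi
      obtain ⟨p, β, ρ', he, h'⟩ := im_var h
      rw [h', ← he]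
    · push Not at hv
      obtain ⟨n, hn, h⟩ := ih _ (hs ▸ sizeOf_im (ha N) hv) (N + 1) rfl
      exact ⟨n, by omega, h⟩

theorem Jumps.env_im {a a' : Node} {E : List (ℕ × Ranked)} (h : a.Jumps E) (h' : a' ∈ a.im) :
    a'.env = E := by
  obtain ⟨i, hi, rfl⟩ := h
  rcases a with ⟨φ, ρ⟩
  obtain rfl : φ = .var i := hi
  obtain ⟨p, β, ρ', he, rfl⟩ := im_var h'
  exact he.symm

theorem Jumps.lead_eq {a : Node} {p : ℕ} {β : Ranked} {ρ : List (ℕ × Ranked)}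
    (h : a.Jumps ((p, β) :: ρ)) : a.lead = p := by
  obtain ⟨i, hi, he⟩ := h
  simp only [lead, hi, he]

theorem Jumps.prio_eq {a : Node} {p : ℕ} {β : Ranked} {ρ : List (ℕ × Ranked)} {m : ℕ}
    (h : a.Jumps ((p, β) :: ρ)) : a.prio m = p := by
  obtain ⟨i, hi, he⟩ := h
  simp only [prio, hi, he]

theorem prio_le (m : ℕ) (a : Node) : a.prio m ≤ max m a.lead := by
  rcases a with ⟨φ, ρ⟩
  cases φ <;> simp only [prio, lead, le_max_left]
  split <;> simp [*]

theorem env_im_of_lead_ne {a a' : Node} (h : a' ∈ a.im) (hl : a.lead ≠ 0) :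
    ∃ β ρ, a'.env = (a.lead, β) :: ρ := by
  rcases a with ⟨φ, ρ⟩
  cases φ
  case var i =>
    obtain ⟨p, β, ρ', he, rfl⟩ := im_var h
    exact ⟨β, ρ', by simp [lead, he]⟩
  case fix p φ =>
    simp only [im, List.mem_singleton] at h
    subst h
    exact ⟨φ, ρ, rfl⟩
  all_goals exact absurd rfl hl

/-- The nodes that can be reached without unfolding variables. -/
def parse : Ranked → List (ℕ × Ranked) → List Node
  | .and φ ψ, ρ => ⟨.and φ ψ, ρ⟩ :: (parse φ ρ ++ parse ψ ρ)
  | .or φ ψ, ρ => ⟨.or φ ψ, ρ⟩ :: (parse φ ρ ++ parse ψ ρ)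
  | .dia φ, ρ => ⟨.dia φ, ρ⟩ :: parse φ ρ
  | .box φ, ρ => ⟨.box φ, ρ⟩ :: parse φ ρ
  | .fix p φ, ρ => ⟨.fix p φ, ρ⟩ :: parse φ ((p, φ) :: ρ)
  | φ, ρ => [⟨φ, ρ⟩]

theorem self_mem_parse (φ : Ranked) (ρ : List (ℕ × Ranked)) : ⟨φ, ρ⟩ ∈ parse φ ρ := by
  cases φ <;> simp [parse]

theorem hereditary_parse (φ : Ranked) (ρ : List (ℕ × Ranked)) :
    Hereditary fun a => a ∈ parse φ ρ := by
  intro a a' h hv ha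
  induction φ generalizing ρ with
  | and φ ψ ih1 ih2 =>
    simp only [parse, List.mem_cons, List.mem_append] at ha ⊢
    rcases ha with rfl | ha | ha
    · simp only [im, List.mem_cons, List.not_mem_nil, or_false] at h
      rcases h with rfl | rfl <;> simp [self_mem_parse]
    · simp [ih1 _ ha]
    · simp [ih2 _ ha]
  | or φ ψ ih1 ih2 =>
    simp only [parse, List.mem_cons, List.mem_append] at ha ⊢
    rcases ha with rfl | ha | ha
    · simp only [im, List.mem_cons, List.not_mem_nil, or_false] at h
      rcases h with rfl | rfl <;> simp [self_mem_parse]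
    · simp [ih1 _ ha]
    · simp [ih2 _ ha]
  | dia φ ih =>
    simp only [parse, List.mem_cons] at ha ⊢
    rcases ha with rfl | ha
    · simp only [im, List.mem_singleton] at h
      simp [h, self_mem_parse]
    · simp [ih _ ha]
  | box φ ih =>
    simp only [parse, List.mem_cons] at ha ⊢
    rcases ha with rfl | ha
    · simp only [im, List.mem_singleton] at h
      simp [h, self_mem_parse]
    · simp [ih _ ha]
  | fix p φ ih =>
    simp only [parse, List.mem_cons] at ha ⊢
    rcases ha with rfl | ha
    · simp only [im, List.mem_singleton] at h
      simp [h, self_mem_parse]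
    · simp [ih _ ha]
  | var i =>
    simp only [parse, List.mem_singleton] at ha
    exact absurd (by rw [ha]) (hv i)
  | _ =>
    simp only [parse, List.mem_singleton] at ha
    simp [ha, im] at h

/-- Unfolding a variable returns to a binding formula that was passed on the way down, so back edges
do not leave the finite parse tree. -/
theorem exists_finite_closed (Ω : Ranked) :
    ∃ S : Set Node, S.Finite ∧ root Ω ∈ S ∧ ∀ a ∈ S, ∀ a' ∈ a.im, a' ∈ S :=
  ⟨{a | Inv (· ∈ parse Ω []) a}, (List.finite_toSet (parse Ω [])).subset fun _ h => h.1,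
    Inv.root (self_mem_parse Ω []), fun _ h _ h' => h.im (hereditary_parse Ω []) h'⟩

/-- Order preservation at a node, and its consequence for nested binders. -/
def Ordered (a : Node) : Prop :=
  Fml.OrderPreservingIn (a.env.map Prod.fst) a.fml ∧
    ∀ i s, Fml.FreeIn i a.fml → (a.env.map Prod.fst)[i]? = some s →
      ∀ k < i, ∀ r, (a.env.map Prod.fst)[k]? = some r → r ≤ s

theorem hereditary_ordered : Hereditary Ordered := by
  rintro ⟨φ, ρ⟩ a' h hv ⟨h1, h2⟩
  cases φ <;> simp only [im, List.mem_cons, List.not_mem_nil, or_false] at h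
  case var i => exact absurd rfl (hv i)
  case and φ ψ =>
    rcases h with rfl | rfl
    · exact ⟨h1.1, fun i s hf => h2 i s (.inl hf)⟩
    · exact ⟨h1.2, fun i s hf => h2 i s (.inr hf)⟩
  case or φ ψ =>
    rcases h with rfl | rfl
    · exact ⟨h1.1, fun i s hf => h2 i s (.inl hf)⟩
    · exact ⟨h1.2, fun i s hf => h2 i s (.inr hf)⟩
  case dia φ => subst h; exact ⟨h1, h2⟩
  case box φ => subst h; exact ⟨h1, h2⟩
  case fix p φ =>
    subst h
    refine ⟨h1.2, fun i s hf hs k hk r hr => ?_⟩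
    rcases i with _ | i
    · omega
    simp only [List.map_cons, List.getElem?_cons_succ] at hs
    rcases k with _ | k
    · simp only [List.map_cons, List.getElem?_cons_zero, Option.some.injEq] at hr
      subst hr
      exact h1.1 i s hs hf
    · simp only [List.map_cons, List.getElem?_cons_succ] at hr
      exact h2 i s hf hs k (by omega) r hr

theorem ordered_root {Ω : Ranked} (h : Ω.OrderPreserving) : Inv Ordered (root Ω) :=
  Inv.root ⟨h, by simp [root]⟩

/-- The labels satisfy `q`. -/
def LabelsIn (q : ℕ → Prop) (a : Node) : Prop :=
  Fml.AllLabels q a.fml ∧ ∀ e ∈ a.env, q e.1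

theorem hereditary_labelsIn (q : ℕ → Prop) : Hereditary (LabelsIn q) := by
  rintro ⟨φ, ρ⟩ a' h hv ⟨h1, h2⟩
  cases φ <;> simp only [im, List.mem_cons, List.not_mem_nil, or_false] at h
  case var i => exact absurd rfl (hv i)
  case and φ ψ => rcases h with rfl | rfl; exacts [⟨h1.1, h2⟩, ⟨h1.2, h2⟩]
  case or φ ψ => rcases h with rfl | rfl; exacts [⟨h1.1, h2⟩, ⟨h1.2, h2⟩]
  case dia φ => subst h; exact ⟨h1, h2⟩
  case box φ => subst h; exact ⟨h1, h2⟩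
  case fix p φ =>
    subst h
    refine ⟨h1.2, fun e he => ?_⟩
    rcases List.mem_cons.1 he with rfl | he
    · exact h1.1
    · exact h2 e he

theorem labelsIn_root {q : ℕ → Prop} {Ω : Ranked} (h : Ω.AllLabels q) :
    Inv (LabelsIn q) (root Ω) :=
  Inv.root ⟨h, by simp [root]⟩

/-- One backward step for `exists_top`: the binders open inside the binder of priority `p` have
priority at most `p`. Such a binder is left only by unfolding a variable bound further out; by order
preservation the priority of that variable bounds the binder's, and it is itself at most `p`. -/
theorem le_of_mem_prefix {E : List (ℕ × Ranked)} {p : ℕ} {β : Ranked}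
    {ρ : List (ℕ × Ranked)} (hE : E = (p, β) :: ρ) {a a' : Node} (ho : Ordered a)
    (h : a' ∈ a.im) (hs' : E <:+ a'.env)
    (ih : ∀ τ, a'.env = τ ++ E → ∀ e ∈ τ, e.1 ≤ p) :
    ∀ τ, a.env = τ ++ E → ∀ e ∈ τ, e.1 ≤ p := by
  intro τ hτ e he
  by_cases hv : ∃ i, a.fml = .var i
  · obtain ⟨i, hi⟩ := hv
    have hd : a'.env = a.env.drop i := Jumps.env_im ⟨i, hi, rfl⟩ h
    have hlen : i ≤ τ.length := by
      have h1 := hs'.length_le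
      have h2 : 0 < E.length := by simp [hE]
      rw [hd, hτ, List.length_drop, List.length_append] at h1
      omega
    rw [hτ, List.drop_append_of_le_length hlen] at hd
    have ih' := ih _ hd
    obtain ⟨k, hk, rfl⟩ := List.mem_iff_getElem.1 he
    by_cases hki : k < i
    -- Entry `k` is skipped by the jump to entry `i`, which either still belongs to `τ` or is the
    -- binder of priority `p` itself.
    · obtain ⟨s, hs, hsp⟩ : ∃ s, (a.env.map Prod.fst)[i]? = some s ∧ s ≤ p := by
        rw [hτ]
        rcases hlen.lt_or_eq with hlt | rfl
        · refine ⟨τ[i].1, ?_, ih' _ ?_⟩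
          · simp [hlt, List.getElem?_append_left]
          · rw [List.mem_iff_getElem]
            exact ⟨0, by simp; omega, by simp⟩
        · exact ⟨p, by simp [hE], le_rfl⟩
      refine (ho.2 i s (by rw [hi]; rfl) hs k hki _ ?_).trans hsp
      rw [hτ]
      simp [hk, List.getElem?_append_left]
    · refine ih' _ ?_
      rw [List.mem_iff_getElem]
      exact ⟨k - i, by simp; omega, by simp [Nat.add_sub_cancel' (not_lt.1 hki)]⟩
  · push Not at hv
    rcases Node.env_im h hv with h' | ⟨q, _, h'⟩
    · exact ih τ (h'.trans hτ) e he
    · exact ih (_ :: τ) (by rw [h', hτ, List.cons_append]) e (List.mem_cons_of_mem _ he)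

/-- On an infinite path, some variable is unfolded infinitely often, and from some point on the
path stays inside its binding and no higher priority is seen. -/
theorem exists_top {Ω : Ranked} (hΩ : Ω.OrderPreserving) {a : ℕ → Node} (h0 : a 0 = root Ω)
    (ha : ∀ n, a (n + 1) ∈ (a n).im) :
    ∃ p β ρ, (∃ᶠ n in atTop, (a n).Jumps ((p, β) :: ρ)) ∧
      (∀ᶠ n in atTop, (p, β) :: ρ <:+ (a n).env) ∧ ∀ᶠ n in atTop, (a n).lead ≤ p := by
  classical
  obtain ⟨S, hS, hr, hcl⟩ := exists_finite_closed Ω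
  have hmem : ∀ n, a n ∈ S := fun n => by
    induction n with
    | zero => rwa [h0]
    | succ n ih => exact hcl _ ih _ (ha n)
  have hord : ∀ n, Ordered (a n) := fun n =>
    (Inv.path hereditary_ordered (by rw [h0]; exact ordered_root hΩ) ha n).1
  have hfreq : ∃ᶠ n in atTop, (a n).Jumps (a (n + 1)).env :=
    frequently_atTop.2 fun N => exists_jumps ha N
  have hex : ∃ d, ∃ᶠ n in atTop, (a n).Jumps (a (n + 1)).env ∧ (a (n + 1)).env.length = d := by
    obtain ⟨x, _, hx⟩ := exists_frequently_eq (hS.image fun x : Node => x.env.length) hfreq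
      (f := fun n => (a (n + 1)).env.length) fun n => ⟨_, hmem (n + 1), rfl⟩
    exact ⟨x, hx⟩
  -- `d` is the least length of an environment to which the path jumps infinitely often. The
  -- environment at such a jump after time `N` is the one sought.
  set d := Nat.find hex with hd
  have hd1 : ∃ᶠ n in atTop, (a n).Jumps (a (n + 1)).env ∧ (a (n + 1)).env.length = d :=
    Nat.find_spec hex
  have hd2 : ∀ᶠ n in atTop, (a n).Jumps (a (n + 1)).env → d ≤ (a (n + 1)).env.length := by
    have : ∀ k ∈ Set.Iio d, ∀ᶠ n in atTop,
        ¬ ((a n).Jumps (a (n + 1)).env ∧ (a (n + 1)).env.length = k) := fun k hk =>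
      not_frequently.1 (Nat.find_min hex hk)
    refine ((eventually_all_finite (Set.finite_Iio d)).2 this).mono fun n hn hj => ?_
    by_contra! hlt
    exact hn _ hlt ⟨hj, rfl⟩
  obtain ⟨N, hN⟩ := eventually_atTop.1 hd2
  obtain ⟨n0, hn0, hj0, hl0⟩ := frequently_atTop.1 hd1 N
  obtain ⟨p, β, ρ, hE⟩ : ∃ p β ρ, (a (n0 + 1)).env = (p, β) :: ρ := by
    obtain ⟨i, hi, _⟩ := hj0
    have h := ha n0
    generalize a n0 = x at hi h
    rcases x with ⟨φ, ρ⟩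
    obtain rfl : φ = .var i := hi
    obtain ⟨p, β, ρ', _, h'⟩ := im_var h
    exact ⟨p, β, ρ', by rw [h']⟩
  -- Only jumps shorten the environment, and after time `N` none of them makes it shorter than `d`,
  -- the length of `(p, β) :: ρ`.
  have hsuf : ∀ n ≥ n0 + 1, (p, β) :: ρ <:+ (a n).env := by
    intro n hn
    induction n, hn using Nat.le_induction with
    | base => rw [hE]
    | succ n hn ih =>
      by_cases hv : ∃ i, (a n).fml = .var i
      · obtain ⟨i, hi⟩ := hv
        have hdr : (a (n + 1)).env = (a n).env.drop i := Jumps.env_im ⟨i, hi, rfl⟩ (ha n)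
        have := hN n (by omega) ⟨i, hi, hdr.symm⟩
        refine List.suffix_of_suffix_length_le ih (hdr ▸ List.drop_suffix _ _) ?_
        rw [← hE, hl0]
        exact this
      · push Not at hv
        rcases env_im (ha n) hv with h | ⟨q, _, h⟩
        · rwa [h]
        · rw [h]
          exact ih.trans (List.suffix_cons _ _)
  have hjump : ∃ᶠ n in atTop, (a n).Jumps ((p, β) :: ρ) := by
    refine (hd1.and_eventually (eventually_ge_atTop (n0 + 1))).mono ?_
    rintro n ⟨⟨hj, hl⟩, hn⟩
    have := (hsuf (n + 1) (by omega)).eq_of_length (by rw [hl, ← hl0, hE])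
    rwa [← this] at hj
  -- The path will jump to `(p, β) :: ρ` again; the induction runs backwards from that jump, right
  -- after which no further binder is open.
  have hpre : ∀ n ≥ n0 + 1, ∀ τ, (a n).env = τ ++ (p, β) :: ρ → ∀ e ∈ τ, e.1 ≤ p := by
    intro n hn
    obtain ⟨n', hn', hj⟩ := frequently_atTop.1 hjump n
    obtain ⟨k, rfl⟩ := Nat.exists_eq_add_of_le hn'
    clear hn'
    induction k generalizing n with
    | zero =>
      refine le_of_mem_prefix rfl (hord n) (ha n) (hsuf _ (by omega)) fun τ hτ e he => ?_
      rw [hj.env_im (ha n)] at hτ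
      have := congrArg List.length hτ
      rw [List.length_append] at this
      rw [List.length_eq_zero_iff.1 (by omega : τ.length = 0)] at he
      simp at he
    | succ k ih =>
      refine le_of_mem_prefix rfl (hord n) (ha n) (hsuf _ (by omega)) (ih (n + 1) (by omega) ?_)
      rwa [Nat.add_right_comm]
  refine ⟨p, β, ρ, hjump, eventually_atTop.2 ⟨_, hsuf⟩,
    eventually_atTop.2 ⟨n0 + 1, fun n hn => ?_⟩⟩
  by_cases hl : (a n).lead = 0
  · omega
  -- A nonzero lead stands at the head of the next environment, and that head is either the binder
  -- of priority `p` or covered by `hpre`.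
  obtain ⟨γ, ρ', he⟩ := env_im_of_lead_ne (ha n) hl
  obtain ⟨τ, hτ⟩ := hsuf (n + 1) (by omega)
  rcases τ with _ | ⟨e, τ⟩
  · rw [he] at hτ
    injection hτ with h1
    injection h1 with h1
    exact h1.ge
  · have := hpre (n + 1) (by omega) _ hτ.symm e List.mem_cons_self
    rw [he] at hτ
    injection hτ with h1
    rwa [h1] at this

end Node

theorem im_of_isPlay {T : Struct} {m : ℕ} {Ω : Ranked} {π : ℕ → (arena T m Ω).V}
    (hπ : (arena T m Ω).IsPlay π) :
    (π 0).2 = Node.root Ω ∧ ∀ n, (π (n + 1)).2 ∈ (π n).2.im :=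
  ⟨by rw [hπ.1]; rfl, fun n => (hπ.2 n).1⟩

/-- The dominant priority is that of the topmost variable that is unfolded infinitely often. -/
theorem evenDominant_arena_iff {T : Struct} {m : ℕ} {Ω : Ranked}
    (hΩ : Ω.AllLabels (m ≤ ·)) {π : ℕ → (arena T m Ω).V} (hπ : (arena T m Ω).IsPlay π)
    {p : ℕ} {β : Ranked} {ρ : List (ℕ × Ranked)}
    (h1 : ∃ᶠ n in atTop, (π n).2.Jumps ((p, β) :: ρ))
    (h2 : ∀ᶠ n in atTop, (π n).2.lead ≤ p) :
    (arena T m Ω).EvenDominant π ↔ Even p := by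
  -- All positions other than variables have priority `m`, so `p` dominates only if it is at least
  -- `m`.
  have hm : m ≤ p := by
    obtain ⟨h0, ha⟩ := im_of_isPlay hπ
    obtain ⟨n, i, _, he⟩ := h1.exists
    have := (Node.Inv.path (a := fun n => (π n).2) (Node.hereditary_labelsIn (m ≤ ·))
      (by rw [h0]; exact Node.labelsIn_root hΩ) ha n).1.2 (p, β)
    exact this (List.mem_of_mem_drop (by rw [he]; exact List.mem_cons_self))
  have hf : ∃ᶠ n in atTop, (arena T m Ω).prio (π n) = p := h1.mono fun n hn => hn.prio_eq
  have he : ∀ᶠ n in atTop, (arena T m Ω).prio (π n) ≤ p := h2.mono fun n hn =>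
    (Node.prio_le m _).trans (max_le hm hn)
  constructor
  · rintro ⟨p', hp', hf', he'⟩
    obtain ⟨n, hn, hn'⟩ := (hf.and_eventually he').exists
    obtain ⟨k, hk, hk'⟩ := (hf'.and_eventually he).exists
    obtain rfl : p' = p := by omega
    exact hp'
  · exact fun hp => ⟨p, hp, hf, he⟩

/-! ### Independence of the priority assignment -/

namespace Node

/-- Nodes that differ in the priorities only. -/
def Similar (a a' : Node) : Prop :=
  a.fml.erase = a'.fml.erase ∧
    List.Forall₂ (fun e e' => (Even e.1 ↔ Even e'.1) ∧ e.2.erase = e'.2.erase) a.env a'.env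

theorem Similar.isModal {a a' : Node} (h : Similar a a') : a.isModal = a'.isModal := by
  obtain ⟨h, _⟩ := h
  unfold Node.isModal
  cases ha : a.fml <;> cases ha' : a'.fml <;> simp_all [Fml.erase]

theorem Similar.oddAt {a a' : Node} (h : Similar a a') (L : Set PropVar) :
    a.OddAt L ↔ a'.OddAt L := by
  obtain ⟨h, _⟩ := h
  unfold Node.OddAt
  cases ha : a.fml <;> cases ha' : a'.fml <;> simp_all [Fml.erase]

theorem Similar.im {a a' : Node} (h : Similar a a') : List.Forall₂ Similar a.im a'.im := by
  rcases a with ⟨φ, ρ⟩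
  rcases a' with ⟨φ', ρ'⟩
  obtain ⟨h, hρ⟩ := h
  dsimp only at h hρ
  cases φ <;> cases φ' <;> simp only [Fml.erase, reduceCtorEq] at h
  case var.var i j =>
    obtain rfl : i = j := by simpa using h
    have hd := List.forall₂_drop i hρ
    simp only [Node.im]
    cases hd1 : ρ.drop i <;> cases hd2 : ρ'.drop i <;> rw [hd1, hd2] at hd <;> cases hd
    · exact .nil
    · rename_i e1 e2
      exact .cons ⟨e1.2, .cons e1 e2⟩ .nil
  case fix.fix p φ q ψ =>
    injection h with h1 h2
    refine .cons ⟨h2, .cons ⟨?_, h2⟩ hρ⟩ .nil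
    split_ifs at h1 <;> tauto
  case and.and => injection h with h1 h2; exact .cons ⟨h1, hρ⟩ (.cons ⟨h2, hρ⟩ .nil)
  case or.or => injection h with h1 h2; exact .cons ⟨h1, hρ⟩ (.cons ⟨h2, hρ⟩ .nil)
  case dia.dia => injection h with h1; exact .cons ⟨h1, hρ⟩ .nil
  case box.box => injection h with h1; exact .cons ⟨h1, hρ⟩ .nil
  all_goals exact .nil

theorem Similar.symm {a a' : Node} (h : Similar a a') : Similar a' a :=
  ⟨h.1.symm, (h.2.imp fun _ _ h => ⟨h.1.symm, h.2.symm⟩).flip⟩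

/-- Similar nodes have environments of equal length, so the depths of the topmost variables of two
parallel paths can be compared at a jump of one of them. -/
theorem length_le_of_similar {a a' : ℕ → Node} (h : ∀ n, Similar (a n) (a' n))
    (ha : ∀ n, a (n + 1) ∈ (a n).im) {E E' : List (ℕ × Ranked)}
    (h1 : ∃ᶠ n in atTop, (a n).Jumps E) (h2 : ∀ᶠ n in atTop, E' <:+ (a' n).env) :
    E'.length ≤ E.length := by
  obtain ⟨n, hn, hn'⟩ := (h1.and_eventually ((tendsto_add_atTop_nat 1).eventually h2)).exists
  rw [← hn.env_im (ha n), (h (n + 1)).2.length_eq]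
  exact hn'.length_le

end Node

theorem _root_.List.Forall₂.exists_of_mem_left {α β : Type*} {R : α → β → Prop} {l : List α}
    {l' : List β} (h : List.Forall₂ R l l') {x : α} (hx : x ∈ l) : ∃ y ∈ l', R x y := by
  induction h with
  | nil => simp at hx
  | cons h _ ih =>
    rcases List.mem_cons.1 hx with rfl | hx
    · exact ⟨_, List.mem_cons_self, h⟩
    · obtain ⟨y, hy, h'⟩ := ih hx
      exact ⟨y, List.mem_cons_of_mem _ hy, h'⟩

/-- Both games run through the same formulas. The topmost variable of `exists_top` is determined by
its depth among the binders, hence is the same on both sides, and its parity is fixed by its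
fixpoint operator. -/
theorem evenWins_arena_congr {T : Struct} {m m' : ℕ} {Ω Ω' : Ranked}
    (hl : Ω.AllLabels (m ≤ ·)) (hl' : Ω'.AllLabels (m' ≤ ·)) (ho : Ω.OrderPreserving)
    (ho' : Ω'.OrderPreserving) (he : Ω.erase = Ω'.erase) :
    (arena T m Ω).EvenWins ↔ (arena T m' Ω').EvenWins := by
  have key : ∀ {u v u' : T.S × Node} {m1 m2 Ω1 Ω2}, u.1 = v.1 → Node.Similar u.2 v.2 →
      (arena T m1 Ω1).edge u u' →
        ∃ v' : T.S × Node, (arena T m2 Ω2).edge v v' ∧ u'.1 = v'.1 ∧ Node.Similar u'.2 v'.2 := by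
    rintro ⟨s, a⟩ ⟨_, a'⟩ ⟨s', b⟩ _ _ _ _ rfl hR ⟨hb, hs⟩
    obtain ⟨b', hb', hbb'⟩ := hR.im.exists_of_mem_left hb
    refine ⟨(s', b'), ⟨hb', ?_⟩, rfl, hbb'⟩
    dsimp only at hs ⊢
    rwa [← hR.isModal]
  refine ParityGame.StutterBisim.evenWins_iff
    { R := fun u v => u.1 = v.1 ∧ Node.Similar u.2 v.2
      idle := fun _ => False
      size := fun _ => 0
      init := ⟨rfl, he, .nil⟩
      size_idle := False.elim
      rel_idle := fun _ => False.elim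
      exists_idle := fun _ => False.elim
      odd_iff := ?_
      forth := fun hR _ h => key hR.1 hR.2 h
      back := ?_
      dominant_iff := ?_ }
  · rintro ⟨s, a⟩ ⟨_, a'⟩ ⟨rfl, hR⟩ _
    exact hR.oddAt _
  · rintro u v v' hR _ h
    obtain ⟨u', h1, h2, h3⟩ := key hR.1.symm hR.2.symm h
    exact ⟨u', h1, h2.symm, h3.symm⟩
  · intro π π' κ hπ hπ' hκ _ hκ' hR
    have hid : ∀ n, κ n = n := fun n => by
      induction n with
      | zero => exact hκ
      | succ n ih => rw [hκ' n not_false, ih]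
    simp only [hid] at hR
    obtain ⟨h0, ha⟩ := im_of_isPlay hπ
    obtain ⟨h0', ha'⟩ := im_of_isPlay hπ'
    obtain ⟨p, β, ρ, hj, hs, hle⟩ := Node.exists_top ho h0 ha
    obtain ⟨p', β', ρ', hj', hs', hle'⟩ := Node.exists_top ho' h0' ha'
    rw [evenDominant_arena_iff hl hπ hj hle, evenDominant_arena_iff hl' hπ' hj' hle']
    have hlen := Node.length_le_of_similar (fun n => (hR n).2) ha hj hs'
    have hlen' := Node.length_le_of_similar (fun n => (hR n).2.symm) ha' hj' hs
    obtain ⟨n, hn, hn'⟩ :=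
      (hj.and_eventually ((tendsto_add_atTop_nat 1).eventually hs')).exists
    have hF := (hR (n + 1)).2.2
    have e := hn.env_im (ha n)
    have e' := hn'.eq_of_length (by
      rw [← hF.length_eq, e]
      exact le_antisymm hlen hlen')
    rw [e, ← e'] at hF
    cases hF with
    | cons h _ => exact h.1

theorem Fml.AllLabels.mono {κ : Type} {q q' : κ → Prop} (h : ∀ k, q k → q' k) {φ : Fml κ}
    (hφ : φ.AllLabels q) : φ.AllLabels q' := by
  induction φ with
  | and φ ψ ih1 ih2 => exact ⟨ih1 hφ.1, ih2 hφ.2⟩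
  | or φ ψ ih1 ih2 => exact ⟨ih1 hφ.1, ih2 hφ.2⟩
  | dia φ ih => exact ih hφ
  | box φ ih => exact ih hφ
  | fix k φ ih => exact ⟨h _ hφ.1, ih hφ.2⟩
  | _ => trivial

theorem sat_iff_evenWins {T : Struct} {Φ : Formula} {m q : ℕ} {Ω : Ranked}
    (h : IsPriorityAssignment m q Ω Φ) (ho : Ω.OrderPreserving) :
    Sat T Φ ↔ (arena T m Ω).EvenWins := by
  constructor
  · rintro ⟨m', q', Ω', h', ho', hw⟩
    exact (evenWins_arena_congr (h'.mem.mono fun _ h => h.1) (h.mem.mono fun _ h => h.1) ho' ho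
      (h'.erase_eq.trans h.erase_eq.symm)).1 hw
  · exact fun hw => ⟨m, q, Ω, h, ho, hw⟩


/-! ### Erasing priorities; literals and constants -/

namespace Fml

theorem freeIn_erase {φ : Ranked} {i : ℕ} : φ.erase.FreeIn i ↔ φ.FreeIn i := by
  induction φ generalizing i <;> simp_all [erase, FreeIn]

theorem guardedVar_erase {φ : Ranked} {i : ℕ} : φ.erase.GuardedVar i ↔ φ.GuardedVar i := by
  induction φ generalizing i <;> simp_all [erase, GuardedVar]

theorem guarded_erase {φ : Ranked} : φ.erase.Guarded ↔ φ.Guarded := by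
  induction φ <;> simp_all [erase, Guarded, guardedVar_erase]

/-- Literals and constants. -/
def IsLeaf : Ranked → Prop
  | pos _ => True
  | neg _ => True
  | bot => True
  | top => True
  | _ => False

theorem IsLeaf.not_freeIn {φ : Ranked} (h : φ.IsLeaf) (i : ℕ) : ¬ φ.FreeIn i := by
  cases φ <;> simp_all [IsLeaf, FreeIn]

theorem IsLeaf.orderPreservingIn {φ : Ranked} (h : φ.IsLeaf) (ρ : List ℕ) :
    φ.OrderPreservingIn ρ := by
  cases φ <;> simp_all [IsLeaf, OrderPreservingIn]

theorem IsLeaf.allLabels {φ : Ranked} (h : φ.IsLeaf) (q : ℕ → Prop) : φ.AllLabels q := by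
  cases φ <;> simp_all [IsLeaf, AllLabels]

theorem IsLeaf.guardedVar {φ : Ranked} (h : φ.IsLeaf) (i : ℕ) : φ.GuardedVar i := by
  cases φ <;> simp_all [IsLeaf, GuardedVar]

theorem IsLeaf.guarded {φ : Ranked} (h : φ.IsLeaf) : φ.Guarded := by
  cases φ <;> simp_all [IsLeaf, Guarded]

end Fml

namespace Node

/-! ### Guardedness -/

/-- The number of steps that can be made from a formula without passing a modality, where `v` holds
this number for the binding formulas of the free variables. -/
def height : List ℕ → Ranked → ℕ
  | v, .and φ ψ => max (height v φ) (height v ψ) + 1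
  | v, .or φ ψ => max (height v φ) (height v ψ) + 1
  | v, .fix _ φ => height (0 :: v) φ + 1
  | v, .var i => v.getD i 0 + 1
  | _, _ => 0

/-- The heights of the binding formulas in an environment. -/
def heights : List (ℕ × Ranked) → List ℕ
  | [] => []
  | (_, β) :: ρ => height (0 :: heights ρ) β :: heights ρ

/-- The number of steps that can be made from a node of a guarded sentence without passing
a modality. -/
def modalHeight (a : Node) : ℕ := height (heights a.env) a.fml

theorem drop_heights (ρ : List (ℕ × Ranked)) (i : ℕ) :
    (heights ρ).drop i = heights (ρ.drop i) := by
  induction ρ generalizing i with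
  | nil => simp [heights]
  | cons e ρ ih =>
    cases i with
    | zero => rfl
    | succ i => simpa [heights] using ih i

/-- A guarded variable is not reached before a modality, so the value assigned to it is irrelevant.
This justifies the value `0` that `height` uses for a variable inside its own binding. -/
theorem height_congr {φ : Ranked} {i : ℕ} (h : φ.GuardedVar i) {v w : List ℕ}
    (e : ∀ j ≠ i, v.getD j 0 = w.getD j 0) : height v φ = height w φ := by
  induction φ generalizing i v w with
  | var j => simp only [height, e j h]
  | and φ ψ ih1 ih2 => simp only [height, ih1 h.1 e, ih2 h.2 e]
  | or φ ψ ih1 ih2 => simp only [height, ih1 h.1 e, ih2 h.2 e]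
  | fix p φ ih =>
    simp only [height]
    rw [ih h]
    rintro (_ | j) hj
    · rfl
    · simpa using e j (by omega)
  | _ => rfl

/-- The formula and the binding formulas around it are guarded. -/
def GuardedIn (a : Node) : Prop :=
  Fml.Guarded a.fml ∧ ∀ e ∈ a.env, Fml.GuardedVar 0 e.2

theorem hereditary_guardedIn : Hereditary GuardedIn := by
  rintro ⟨φ, ρ⟩ a' h hv ⟨h1, h2⟩
  cases φ <;> simp only [im, List.mem_cons, List.not_mem_nil, or_false] at h
  case var i => exact absurd rfl (hv i)
  case and φ ψ => rcases h with rfl | rfl; exacts [⟨h1.1, h2⟩, ⟨h1.2, h2⟩]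
  case or φ ψ => rcases h with rfl | rfl; exacts [⟨h1.1, h2⟩, ⟨h1.2, h2⟩]
  case dia φ => subst h; exact ⟨h1, h2⟩
  case box φ => subst h; exact ⟨h1, h2⟩
  case fix p φ =>
    subst h
    refine ⟨h1.2, fun e he => ?_⟩
    rcases List.mem_cons.1 he with rfl | he
    · exact h1.1
    · exact h2 e he

theorem guardedIn_root {Ω : Ranked} (h : Ω.Guarded) : Inv GuardedIn (root Ω) :=
  Inv.root ⟨h, by simp [root]⟩

theorem modalHeight_body {β : Ranked} (h : β.GuardedVar 0) (p : ℕ) (ρ : List (ℕ × Ranked)) :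
    modalHeight ⟨β, (p, β) :: ρ⟩ = height (0 :: heights ρ) β := by
  refine height_congr h ?_
  rintro (_ | j) hj
  · exact absurd rfl hj
  · rfl

theorem modalHeight_im {a a' : Node} (ha : GuardedIn a) (h : a' ∈ a.im)
    (hm : a.isModal = false) : a'.modalHeight < a.modalHeight := by
  rcases a with ⟨φ, ρ⟩
  cases φ
  case var i =>
    obtain ⟨p, β, ρ', he, rfl⟩ := im_var h
    have hβ : β.GuardedVar 0 :=
      ha.2 (p, β) (List.mem_of_mem_drop (by rw [he]; exact List.mem_cons_self))
    rw [modalHeight_body hβ, modalHeight, height]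
    have hd := drop_heights ρ i
    rw [he, heights] at hd
    have : (heights ρ).getD i 0 = height (0 :: heights ρ') β := by
      have h0 : ((heights ρ).drop i)[0]? = some (height (0 :: heights ρ') β) := by rw [hd]; rfl
      rw [List.getElem?_drop, add_zero] at h0
      simp [List.getD_eq_getElem?_getD, h0]
    exact this ▸ Nat.lt_succ_self _
  all_goals simp only [im, List.mem_cons, List.not_mem_nil, or_false] at h
  case fix p φ =>
    subst h
    rw [modalHeight_body ha.1.1]
    exact Nat.lt_succ_self _
  case and =>
    rcases h with rfl | rfl
    exacts [Nat.lt_succ_of_le (le_max_left _ _), Nat.lt_succ_of_le (le_max_right _ _)]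
  case or =>
    rcases h with rfl | rfl
    exacts [Nat.lt_succ_of_le (le_max_left _ _), Nat.lt_succ_of_le (le_max_right _ _)]
  all_goals simp [isModal] at hm

/-- The conjunctions and disjunctions formed by the product thus have at most two members, and the
rules of `Computes` can list the possibilities. -/
theorem im_cases (a : Node) :
    (a.im = [] ∧ a.isModal = false) ∨ (∃ a', a.im = [a']) ∨
      ∃ a₁ a₂, a.im = [a₁, a₂] ∧ a.isModal = false := by
  rcases a with ⟨φ, ρ⟩
  cases φ
  case var i =>
    rcases he : ρ.drop i with _ | ⟨⟨p, β⟩, ρ'⟩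
    · exact .inl ⟨by simp [im, he], rfl⟩
    · exact .inr (.inl ⟨_, im_of_drop he⟩)
  all_goals simp [im, isModal]

end Node

/-! ### The computation of the product -/

namespace Product

/-- The evaluation relation of the computation of products. -/
inductive Computes (m : ℕ) : List (Node × Node) → Node → Node → Ranked → Prop
  | pos {st a P ρ} : Computes m st a ⟨.pos P, ρ⟩ (atom m a P)
  | neg {st a P ρ} : Computes m st a ⟨.neg P, ρ⟩ (compl (atom m a P))
  | bot {st a ρ} : Computes m st a ⟨.bot, ρ⟩ .bot
  | top {st a ρ} : Computes m st a ⟨.top, ρ⟩ .top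
  | and {st a ψ ψ' ρ x y} : Computes m st a ⟨ψ, ρ⟩ x → Computes m st a ⟨ψ', ρ⟩ y →
      Computes m st a ⟨.and ψ ψ', ρ⟩ (.and x y)
  | or {st a ψ ψ' ρ x y} : Computes m st a ⟨ψ, ρ⟩ x → Computes m st a ⟨ψ', ρ⟩ y →
      Computes m st a ⟨.or ψ ψ', ρ⟩ (.or x y)
  | boxModal {st a a' ψ ρ x} : a.isModal = true → a.im = [a'] → Computes m st a' ⟨ψ, ρ⟩ x →
      Computes m st a ⟨.box ψ, ρ⟩ (.box x)
  | boxNil {st a ψ ρ} : a.isModal = false → a.im = [] → Computes m st a ⟨.box ψ, ρ⟩ .top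
  | boxOne {st a a' ψ ρ x} : a.isModal = false → a.im = [a'] → Computes m st a' ⟨ψ, ρ⟩ x →
      Computes m st a ⟨.box ψ, ρ⟩ x
  | boxTwo {st a a₁ a₂ ψ ρ x y} : a.isModal = false → a.im = [a₁, a₂] →
      Computes m st a₁ ⟨ψ, ρ⟩ x → Computes m st a₂ ⟨ψ, ρ⟩ y →
      Computes m st a ⟨.box ψ, ρ⟩ (.and x y)
  | diaModal {st a a' ψ ρ x} : a.isModal = true → a.im = [a'] → Computes m st a' ⟨ψ, ρ⟩ x →
      Computes m st a ⟨.dia ψ, ρ⟩ (.dia x)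
  | diaNil {st a ψ ρ} : a.isModal = false → a.im = [] → Computes m st a ⟨.dia ψ, ρ⟩ .bot
  | diaOne {st a a' ψ ρ x} : a.isModal = false → a.im = [a'] → Computes m st a' ⟨ψ, ρ⟩ x →
      Computes m st a ⟨.dia ψ, ρ⟩ x
  | diaTwo {st a a₁ a₂ ψ ρ x y} : a.isModal = false → a.im = [a₁, a₂] →
      Computes m st a₁ ⟨ψ, ρ⟩ x → Computes m st a₂ ⟨ψ, ρ⟩ y →
      Computes m st a ⟨.dia ψ, ρ⟩ (.or x y)
  | varNone {st a i ρ} : ρ.drop i = [] → Computes m st a ⟨.var i, ρ⟩ .bot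
  | varFound {st a i ρ p β ρ' j} : ρ.drop i = (p, β) :: ρ' →
      lookup a ⟨β, (p, β) :: ρ'⟩ st = some j → Computes m st a ⟨.var i, ρ⟩ (.var j)
  | varOpen {st a i ρ p β ρ' x} : ρ.drop i = (p, β) :: ρ' →
      lookup a ⟨β, (p, β) :: ρ'⟩ st = none →
      Computes m ((a, ⟨β, (p, β) :: ρ'⟩) :: st) a ⟨β, (p, β) :: ρ'⟩ x →
      Computes m st a ⟨.var i, ρ⟩ (.fix p x)
  | fix {st a p β ρ x} : Computes m ((a, ⟨β, (p, β) :: ρ⟩) :: st) a ⟨β, (p, β) :: ρ⟩ x →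
      Computes m st a ⟨.fix p β, ρ⟩ (.fix p x)

/-- Properties of the result can now be proved by induction on rules instead of fuel. -/
theorem computes_of_run {m fuel : ℕ} {st : List (Node × Node)} {a b : Node} {Ω : Ranked}
    (h : run m fuel st a b = some Ω) : Computes m st a b Ω := by
  induction fuel generalizing st a b Ω with
  | zero => simp [run] at h
  | succ fuel ih =>
    rcases b with ⟨φ, ρ⟩
    cases φ with
    | pos P => obtain rfl := Option.some.inj h; exact .pos
    | neg P => obtain rfl := Option.some.inj h; exact .neg
    | bot => obtain rfl := Option.some.inj h; exact .bot
    | top => obtain rfl := Option.some.inj h; exact .top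
    | and ψ ψ' =>
      simp only [run, Option.bind_eq_bind, Option.bind_eq_some_iff, Option.pure_def,
        Option.some.injEq] at h
      obtain ⟨x, hx, y, hy, rfl⟩ := h
      exact .and (ih hx) (ih hy)
    | or ψ ψ' =>
      simp only [run, Option.bind_eq_bind, Option.bind_eq_some_iff, Option.pure_def,
        Option.some.injEq] at h
      obtain ⟨x, hx, y, hy, rfl⟩ := h
      exact .or (ih hx) (ih hy)
    | dia ψ =>
      rcases a.im_cases with ⟨h1, h2⟩ | ⟨a', h1⟩ | ⟨a₁, a₂, h1, h2⟩
      · simp [run, h1, h2, disj] at h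
        subst h
        exact .diaNil h2 h1
      · simp [run, h1, disj, Option.bind_eq_some_iff] at h
        obtain ⟨x, hx, h⟩ := h
        cases hm : a.isModal
        · obtain rfl : x = Ω := by simpa [hm] using h
          exact .diaOne hm h1 (ih hx)
        · obtain rfl : Fml.dia x = Ω := by simpa [hm] using h
          exact .diaModal hm h1 (ih hx)
      · simp [run, h1, h2, disj, Option.bind_eq_some_iff] at h
        obtain ⟨x, hx, y, hy, rfl⟩ := h
        exact .diaTwo h2 h1 (ih hx) (ih hy)
    | box ψ =>
      rcases a.im_cases with ⟨h1, h2⟩ | ⟨a', h1⟩ | ⟨a₁, a₂, h1, h2⟩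
      · simp [run, h1, h2, conj] at h
        subst h
        exact .boxNil h2 h1
      · simp [run, h1, conj, Option.bind_eq_some_iff] at h
        obtain ⟨x, hx, h⟩ := h
        cases hm : a.isModal
        · obtain rfl : x = Ω := by simpa [hm] using h
          exact .boxOne hm h1 (ih hx)
        · obtain rfl : Fml.box x = Ω := by simpa [hm] using h
          exact .boxModal hm h1 (ih hx)
      · simp [run, h1, h2, conj, Option.bind_eq_some_iff] at h
        obtain ⟨x, hx, y, hy, rfl⟩ := h
        exact .boxTwo h2 h1 (ih hx) (ih hy)
    | var i =>
      rcases he : ρ.drop i with _ | ⟨⟨p, β⟩, ρ'⟩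
      · simp only [run, he, Option.some.injEq] at h
        subst h
        exact .varNone he
      · cases hl : lookup a ⟨β, (p, β) :: ρ'⟩ st with
        | some j =>
          simp only [run, he, hl, Option.some.injEq] at h
          subst h
          exact .varFound he hl
        | none =>
          simp only [run, he, hl, Option.bind_eq_bind, Option.bind_eq_some_iff, Option.pure_def,
            Option.some.injEq] at h
          obtain ⟨x, hx, rfl⟩ := h
          exact .varOpen he hl (ih hx)
    | fix p β =>
      simp only [run, Option.bind_eq_bind, Option.bind_eq_some_iff, Option.pure_def,
        Option.some.injEq] at h
      obtain ⟨x, hx, rfl⟩ := h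
      exact .fix (ih hx)

/-! ### Order preservation, labels and guardedness of the result -/

theorem isLeaf_atom (m : ℕ) (a : Node) (P : PropVar) : (atom m a P).IsLeaf := by
  rcases a with ⟨φ, ρ⟩
  cases φ <;> simp only [atom, ofBool] <;> split_ifs <;> trivial

theorem isLeaf_compl {φ : Ranked} (h : φ.IsLeaf) : (compl φ).IsLeaf := by
  cases φ <;> simp_all [Fml.IsLeaf, compl]

theorem lookup_eq_some {a x : Node} {st : List (Node × Node)} {j : ℕ}
    (h : lookup a x st = some j) :
    st[j]? = some (a, x) ∧ ∀ k < j, ∀ e, st[k]? = some e → rank e.2 ≤ rank x := by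
  induction st generalizing j with
  | nil => simp [lookup] at h
  | cons e st ih =>
    simp only [lookup] at h
    split_ifs at h with h1 h2
    · obtain rfl : 0 = j := by simpa using h
      simp [h1]
    · obtain ⟨k, hk, rfl⟩ := Option.map_eq_some_iff.1 h
      obtain ⟨h3, h4⟩ := ih hk
      refine ⟨h3, fun l hl e' he' => ?_⟩
      rcases l with _ | l
      · obtain rfl : e = e' := by simpa using he'
        omega
      · exact h4 l (by omega) e' he'

theorem lookup_ne_none {a x : Node} {τ st : List (Node × Node)}
    (h : ∀ e ∈ τ, rank e.2 ≤ rank x) : lookup a x (τ ++ (a, x) :: st) ≠ none := by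
  induction τ with
  | nil => simp [lookup]
  | cons e τ ih =>
    simp only [List.cons_append, lookup]
    split_ifs with h1 h2
    · simp
    · exact absurd h2 (not_lt.2 (h e List.mem_cons_self))
    · simpa using ih fun e he => h e (List.mem_cons_of_mem _ he)

/-- A free variable of the result comes from a successful `lookup`, which does not pass a binder of
higher priority. -/
theorem Computes.exists_of_freeIn {m : ℕ} {st : List (Node × Node)} {a b : Node} {Ω : Ranked}
    (h : Computes m st a b Ω) {i : ℕ} (hi : Ω.FreeIn i) :
    ∃ e, st[i]? = some e ∧ ∀ k < i, ∀ e', st[k]? = some e' → rank e'.2 ≤ rank e.2 := by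
  -- Closing the innermost binder shifts the indices of the remaining free variables by one.
  have push : ∀ {st : List (Node × Node)} {d : Node × Node} {i : ℕ},
      (∃ e, (d :: st)[i + 1]? = some e ∧
        ∀ k < i + 1, ∀ e', (d :: st)[k]? = some e' → rank e'.2 ≤ rank e.2) →
      ∃ e, st[i]? = some e ∧ ∀ k < i, ∀ e', st[k]? = some e' → rank e'.2 ≤ rank e.2 := by
    rintro st d i ⟨e, h1, h2⟩
    exact ⟨e, h1, fun k hk e' he' => h2 (k + 1) (by omega) e' he'⟩
  induction h generalizing i with
  | pos => exact absurd hi ((isLeaf_atom _ _ _).not_freeIn i)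
  | neg => exact absurd hi ((isLeaf_compl (isLeaf_atom _ _ _)).not_freeIn i)
  | and _ _ ih1 ih2 => exact hi.elim ih1 ih2
  | or _ _ ih1 ih2 => exact hi.elim ih1 ih2
  | boxTwo _ _ _ _ ih1 ih2 => exact hi.elim ih1 ih2
  | diaTwo _ _ _ _ ih1 ih2 => exact hi.elim ih1 ih2
  | boxModal _ _ _ ih => exact ih hi
  | boxOne _ _ _ ih => exact ih hi
  | diaModal _ _ _ ih => exact ih hi
  | diaOne _ _ _ ih => exact ih hi
  | varFound he hl =>
    obtain rfl : _ = i := hi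
    exact ⟨_, lookup_eq_some hl⟩
  | varOpen _ _ _ ih => exact push (ih hi)
  | fix _ ih => exact push (ih hi)
  | _ => exact absurd hi id

/-- In the body of a new binder, entry `0` of the stack is that binder, so `exists_of_freeIn` bounds
its priority by that of each variable free around it. -/
theorem Computes.orderPreservingIn {m : ℕ} {st : List (Node × Node)} {a b : Node} {Ω : Ranked}
    (h : Computes m st a b Ω) : Ω.OrderPreservingIn (st.map fun e => rank e.2) := by
  have bind : ∀ {st : List (Node × Node)} {a x : Node} {Ω : Ranked},
      Computes m ((a, x) :: st) a x Ω → ∀ i r, (st.map fun e => rank e.2)[i]? = some r →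
        Ω.FreeIn (i + 1) → rank x ≤ r := by
    intro st a x Ω h i r hr hf
    obtain ⟨e, h1, h2⟩ := h.exists_of_freeIn hf
    have := h2 0 (by omega) (a, x) rfl
    rw [List.getElem?_cons_succ] at h1
    rw [List.getElem?_map, h1] at hr
    obtain rfl := Option.some.inj hr
    exact this
  induction h with
  | pos => exact (isLeaf_atom _ _ _).orderPreservingIn _
  | neg => exact (isLeaf_compl (isLeaf_atom _ _ _)).orderPreservingIn _
  | and _ _ ih1 ih2 => exact ⟨ih1, ih2⟩
  | or _ _ ih1 ih2 => exact ⟨ih1, ih2⟩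
  | boxTwo _ _ _ _ ih1 ih2 => exact ⟨ih1, ih2⟩
  | diaTwo _ _ _ _ ih1 ih2 => exact ⟨ih1, ih2⟩
  | boxModal _ _ _ ih => exact ih
  | boxOne _ _ _ ih => exact ih
  | diaModal _ _ _ ih => exact ih
  | diaOne _ _ _ ih => exact ih
  | varOpen _ _ h ih => exact ⟨bind h, ih⟩
  | fix h ih => exact ⟨bind h, ih⟩
  | _ => trivial

theorem Computes.allLabels {m : ℕ} {st : List (Node × Node)} {a b : Node} {Ω : Ranked}
    {q : ℕ → Prop} (h : Computes m st a b Ω) (hb : Node.Inv (Node.LabelsIn q) b) :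
    Ω.AllLabels q := by
  have hq := Node.hereditary_labelsIn q
  induction h with
  | pos => exact (isLeaf_atom _ _ _).allLabels _
  | neg => exact (isLeaf_compl (isLeaf_atom _ _ _)).allLabels _
  | and _ _ ih1 ih2 =>
    exact ⟨ih1 (hb.im hq (by simp [Node.im])), ih2 (hb.im hq (by simp [Node.im]))⟩
  | or _ _ ih1 ih2 =>
    exact ⟨ih1 (hb.im hq (by simp [Node.im])), ih2 (hb.im hq (by simp [Node.im]))⟩
  | boxTwo _ _ _ _ ih1 ih2 =>
    exact ⟨ih1 (hb.im hq (by simp [Node.im])), ih2 (hb.im hq (by simp [Node.im]))⟩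
  | diaTwo _ _ _ _ ih1 ih2 =>
    exact ⟨ih1 (hb.im hq (by simp [Node.im])), ih2 (hb.im hq (by simp [Node.im]))⟩
  | boxModal _ _ _ ih => exact ih (hb.im hq (by simp [Node.im]))
  | boxOne _ _ _ ih => exact ih (hb.im hq (by simp [Node.im]))
  | diaModal _ _ _ ih => exact ih (hb.im hq (by simp [Node.im]))
  | diaOne _ _ _ ih => exact ih (hb.im hq (by simp [Node.im]))
  | varOpen he _ _ ih =>
    have := hb.im hq (by rw [Node.im_of_drop he]; exact List.mem_cons_self)
    exact ⟨this.1.2 _ List.mem_cons_self, ih this⟩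
  | fix _ ih => exact ⟨hb.1.1.1, ih (hb.im hq (by simp [Node.im]))⟩
  | _ => trivial

/-- The second part carries the induction: an unguarded free variable refers to a pair that is
lexicographically smaller in modal heights than the current one. A step of `Win` that is not modal
lowers the second height and keeps the first; a modality of `Win` at a non-modal node of `Ψ` lowers
the first; and if both are modal, the product emits a modality, which guards everything below. -/
theorem Computes.guarded {m : ℕ} {st : List (Node × Node)} {a b : Node} {Ω : Ranked}
    (h : Computes m st a b Ω) (ha : Node.Inv Node.GuardedIn a) (hb : Node.Inv Node.GuardedIn b) :
    Ω.Guarded ∧ ∀ i e, st[i]? = some e → ¬ Ω.GuardedVar i →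
      e.1.modalHeight < a.modalHeight ∨
        e.1.modalHeight = a.modalHeight ∧ e.2.modalHeight < b.modalHeight := by
  have hq := Node.hereditary_guardedIn
  induction h with
  | pos =>
    exact ⟨(isLeaf_atom _ _ _).guarded, fun i e _ hn => absurd ((isLeaf_atom _ _ _).guardedVar i) hn⟩
  | neg =>
    exact ⟨(isLeaf_compl (isLeaf_atom _ _ _)).guarded,
      fun i e _ hn => absurd ((isLeaf_compl (isLeaf_atom _ _ _)).guardedVar i) hn⟩
  | @and _ _ ψ ψ' ρ _ _ _ _ ih1 ih2 =>
    have m1 : (⟨ψ, ρ⟩ : Node) ∈ Node.im ⟨.and ψ ψ', ρ⟩ := by simp [Node.im]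
    have m2 : (⟨ψ', ρ⟩ : Node) ∈ Node.im ⟨.and ψ ψ', ρ⟩ := by simp [Node.im]
    obtain ⟨g1, i1⟩ := ih1 ha (hb.im hq m1)
    obtain ⟨g2, i2⟩ := ih2 ha (hb.im hq m2)
    have l1 := Node.modalHeight_im hb.1 m1 rfl
    have l2 := Node.modalHeight_im hb.1 m2 rfl
    refine ⟨⟨g1, g2⟩, fun i e he hn => ?_⟩
    rcases not_and_or.1 hn with hn | hn
    · have := i1 i e he hn; omega
    · have := i2 i e he hn; omega
  | @or _ _ ψ ψ' ρ _ _ _ _ ih1 ih2 =>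
    have m1 : (⟨ψ, ρ⟩ : Node) ∈ Node.im ⟨.or ψ ψ', ρ⟩ := by simp [Node.im]
    have m2 : (⟨ψ', ρ⟩ : Node) ∈ Node.im ⟨.or ψ ψ', ρ⟩ := by simp [Node.im]
    obtain ⟨g1, i1⟩ := ih1 ha (hb.im hq m1)
    obtain ⟨g2, i2⟩ := ih2 ha (hb.im hq m2)
    have l1 := Node.modalHeight_im hb.1 m1 rfl
    have l2 := Node.modalHeight_im hb.1 m2 rfl
    refine ⟨⟨g1, g2⟩, fun i e he hn => ?_⟩
    rcases not_and_or.1 hn with hn | hn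
    · have := i1 i e he hn; omega
    · have := i2 i e he hn; omega
  | boxModal _ h1 _ ih =>
    exact ⟨(ih (ha.im hq (by simp [h1])) (hb.im hq (by simp [Node.im]))).1,
      fun i e _ hn => absurd trivial hn⟩
  | diaModal _ h1 _ ih =>
    exact ⟨(ih (ha.im hq (by simp [h1])) (hb.im hq (by simp [Node.im]))).1,
      fun i e _ hn => absurd trivial hn⟩
  | @boxOne _ a a' _ _ _ hm h1 _ ih =>
    have m1 : a' ∈ a.im := by simp [h1]
    obtain ⟨g, i1⟩ := ih (ha.im hq m1) (hb.im hq (by simp [Node.im]))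
    have l := Node.modalHeight_im ha.1 m1 hm
    exact ⟨g, fun i e he hn => by have := i1 i e he hn; omega⟩
  | @diaOne _ a a' _ _ _ hm h1 _ ih =>
    have m1 : a' ∈ a.im := by simp [h1]
    obtain ⟨g, i1⟩ := ih (ha.im hq m1) (hb.im hq (by simp [Node.im]))
    have l := Node.modalHeight_im ha.1 m1 hm
    exact ⟨g, fun i e he hn => by have := i1 i e he hn; omega⟩
  | @boxTwo _ a a₁ a₂ _ _ _ _ hm h1 _ _ ih1 ih2 =>
    have m1 : a₁ ∈ a.im := by simp [h1]
    have m2 : a₂ ∈ a.im := by simp [h1]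
    obtain ⟨g1, i1⟩ := ih1 (ha.im hq m1) (hb.im hq (by simp [Node.im]))
    obtain ⟨g2, i2⟩ := ih2 (ha.im hq m2) (hb.im hq (by simp [Node.im]))
    have l1 := Node.modalHeight_im ha.1 m1 hm
    have l2 := Node.modalHeight_im ha.1 m2 hm
    refine ⟨⟨g1, g2⟩, fun i e he hn => ?_⟩
    rcases not_and_or.1 hn with hn | hn
    · have := i1 i e he hn; omega
    · have := i2 i e he hn; omega
  | @diaTwo _ a a₁ a₂ _ _ _ _ hm h1 _ _ ih1 ih2 =>
    have m1 : a₁ ∈ a.im := by simp [h1]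
    have m2 : a₂ ∈ a.im := by simp [h1]
    obtain ⟨g1, i1⟩ := ih1 (ha.im hq m1) (hb.im hq (by simp [Node.im]))
    obtain ⟨g2, i2⟩ := ih2 (ha.im hq m2) (hb.im hq (by simp [Node.im]))
    have l1 := Node.modalHeight_im ha.1 m1 hm
    have l2 := Node.modalHeight_im ha.1 m2 hm
    refine ⟨⟨g1, g2⟩, fun i e he hn => ?_⟩
    rcases not_and_or.1 hn with hn | hn
    · have := i1 i e he hn; omega
    · have := i2 i e he hn; omega
  | varFound hd hl =>
    refine ⟨trivial, fun i e he hn => ?_⟩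
    obtain rfl := not_not.1 hn
    obtain rfl := Option.some.inj (he.symm.trans (lookup_eq_some hl).1)
    exact .inr ⟨rfl, Node.modalHeight_im hb.1 (by rw [Node.im_of_drop hd]; simp) rfl⟩
  | @varOpen _ _ i ρ p β ρ' _ hd _ _ ih =>
    have m1 : (⟨β, (p, β) :: ρ'⟩ : Node) ∈ Node.im ⟨.var i, ρ⟩ := by
      rw [Node.im_of_drop hd]
      exact List.mem_singleton_self _
    obtain ⟨g, i1⟩ := ih ha (hb.im hq m1)
    have l := Node.modalHeight_im hb.1 m1 rfl
    refine ⟨⟨?_, g⟩, fun i e he hn => ?_⟩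
    -- Entry `0` is the very pair being computed, which would have to be smaller than itself.
    · by_contra hn
      have := i1 0 _ rfl hn
      simp only at this
      omega
    · have := i1 (i + 1) e he hn
      omega
  | @fix _ _ p β ρ _ _ ih =>
    have m1 : (⟨β, (p, β) :: ρ⟩ : Node) ∈ Node.im ⟨.fix p β, ρ⟩ := by simp [Node.im]
    obtain ⟨g, i1⟩ := ih ha (hb.im hq m1)
    have l := Node.modalHeight_im hb.1 m1 rfl
    refine ⟨⟨?_, g⟩, fun i e he hn => ?_⟩
    · by_contra hn
      have := i1 0 _ rfl hn
      simp only at this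
      omega
    · have := i1 (i + 1) e he hn
      omega
  | _ => exact ⟨trivial, fun i e _ hn => absurd trivial hn⟩

/-! ### Termination -/

/-- The computation for the second configuration may call that for the first one. -/
inductive Calls : List (Node × Node) × Node × Node → List (Node × Node) × Node × Node → Prop
  | move {st a a' b b'} : b' ∈ b.im → (∀ i, b.fml ≠ .var i) → (a' = a ∨ a' ∈ a.im) →
      Calls (st, a', b') (st, a, b)
  | push {st a b b'} : b' ∈ b.im → rank b' = b.lead →
      ((∃ i, b.fml = .var i) → lookup a b' st = none) → Calls ((a, b') :: st, a, b') (st, a, b)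

theorem Calls.im {c c' : List (Node × Node) × Node × Node} (h : Calls c' c) :
    c'.2.2 ∈ c.2.2.im := by
  cases h <;> assumption

/-- An infinite chain of calls follows an infinite path in `Win`. Its topmost variable is unfolded
infinitely often at one and the same node `a₀` of `Ψ`; the binder opened by one such unfolding is
visible to the next, contrary to the failure of `lookup` there. -/
theorem acc_calls {Ω : Ranked} (hΩ : Ω.OrderPreserving) (a : Node) {S : Set Node}
    (hS : S.Finite) (ha : a ∈ S) (hcl : ∀ a ∈ S, ∀ a' ∈ a.im, a' ∈ S) :
    Acc Calls ([], a, Node.root Ω) := by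
  by_contra hacc
  obtain ⟨f, h0, hf⟩ := not_acc_iff_exists_descending_chain.1 hacc
  have hS' : ∀ n, (f n).2.1 ∈ S := by
    intro n
    induction n with
    | zero => rwa [h0]
    | succ n ih =>
      have h := hf n
      generalize f n = c at h ih
      generalize f (n + 1) = c' at h ⊢
      cases h with
      | move _ _ h =>
        rcases h with rfl | h
        exacts [ih, hcl _ ih _ h]
      | push => exact ih
  obtain ⟨p, β, ρ, hj, -, hle⟩ := Node.exists_top (a := fun n => (f n).2.2) hΩ (by rw [h0])
    fun n => (hf n).im
  obtain ⟨a₀, -, hfr⟩ := exists_frequently_eq hS hj hS'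
  obtain ⟨N, hN⟩ := eventually_atTop.1 hle
  set x : Node := ⟨β, (p, β) :: ρ⟩ with hx
  have hvar : ∀ n, (f n).2.2.Jumps ((p, β) :: ρ) →
      lookup (f n).2.1 x (f n).1 = none ∧ (f (n + 1)).1 = ((f n).2.1, x) :: (f n).1 := by
    rintro n ⟨i, hi, he⟩
    have h := hf n
    generalize f n = c at h hi he
    generalize f (n + 1) = c' at h ⊢
    cases h with
    | move _ h => exact absurd hi (h i)
    | @push _ _ b b' hb _ hl =>
      rcases b with ⟨φ, τ⟩
      obtain rfl : φ = .var i := hi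
      rw [Node.im_of_drop he, List.mem_singleton] at hb
      subst hb
      exact ⟨hl ⟨i, rfl⟩, rfl⟩
  obtain ⟨n₁, hn₁, hj₁, ha₁⟩ := frequently_atTop.1 hfr N
  -- Along the chain the stack only grows, and what is pushed after time `N` has rank at most `p`,
  -- the rank of `x`.
  have hst : ∀ n ≥ n₁ + 1, ∃ τ, (f n).1 = τ ++ (a₀, x) :: (f n₁).1 ∧
      ∀ e ∈ τ, rank e.2 ≤ rank x := by
    intro n hn
    induction n, hn using Nat.le_induction with
    | base => exact ⟨[], by rw [(hvar n₁ hj₁).2, ha₁]; rfl, by simp⟩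
    | succ n hn ih =>
      obtain ⟨τ, hτ, hτ'⟩ := ih
      have h := hf n
      have hl : (f n).2.2.lead ≤ p := hN n (by omega)
      generalize f n = c at h hτ hl
      generalize f (n + 1) = c' at h ⊢
      cases h with
      | move => exact ⟨τ, hτ, hτ'⟩
      | @push st a b b' _ hr _ =>
        refine ⟨(a, b') :: τ, by rw [List.cons_append, ← hτ], fun e he => ?_⟩
        rcases List.mem_cons.1 he with rfl | he
        · exact hr.trans_le hl
        · exact hτ' e he
  obtain ⟨n₂, hn₂, hj₂, ha₂⟩ := frequently_atTop.1 hfr (n₁ + 1)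
  obtain ⟨τ, hτ, hτ'⟩ := hst n₂ hn₂
  refine lookup_ne_none (a := a₀) (st := (f n₁).1) hτ' ?_
  rw [← hτ, ← ha₂]
  exact (hvar n₂ hj₂).1

theorem exists_mapM_eq_some {α β : Type} {f : ℕ → α → Option β} {l : List α}
    (h : ∀ x ∈ l, ∃ y N, ∀ k ≥ N, f k x = some y) :
    ∃ l' N, ∀ k ≥ N, l.mapM (f k) = some l' := by
  induction l with
  | nil => exact ⟨[], 0, fun k _ => by simp⟩
  | cons x l ih =>
    obtain ⟨y, N, hy⟩ := h x List.mem_cons_self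
    obtain ⟨l', N', hl⟩ := ih fun x hx => h x (List.mem_cons_of_mem _ hx)
    refine ⟨y :: l', max N N', fun k hk => ?_⟩
    simp [List.mapM_cons, hy k (by omega), hl k (by omega)]

theorem exists_run_eq_some (m : ℕ) {c : List (Node × Node) × Node × Node} (hc : Acc Calls c) :
    ∃ Ω N, ∀ fuel ≥ N, run m fuel c.1 c.2.1 c.2.2 = some Ω := by
  induction hc with
  | intro c _ ih =>
    have succ : ∀ {st : List (Node × Node)} {a b : Node},
        (∃ Ω N, ∀ fuel ≥ N, run m (fuel + 1) st a b = some Ω) →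
        ∃ Ω N, ∀ fuel ≥ N, run m fuel st a b = some Ω := by
      rintro st a b ⟨Ω, N, h⟩
      refine ⟨Ω, N + 1, fun fuel hf => ?_⟩
      obtain ⟨k, rfl⟩ := Nat.exists_eq_add_of_le' (show 1 ≤ fuel by omega)
      exact h k (by omega)
    obtain ⟨st, a, φ, ρ⟩ := c
    apply succ
    cases φ with
    | pos P => exact ⟨_, 0, fun _ _ => rfl⟩
    | neg P => exact ⟨_, 0, fun _ _ => rfl⟩
    | bot => exact ⟨_, 0, fun _ _ => rfl⟩
    | top => exact ⟨_, 0, fun _ _ => rfl⟩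
    | and ψ ψ' =>
      obtain ⟨x, N, hx⟩ := ih (st, a, ⟨ψ, ρ⟩) (.move (by simp [Node.im]) (by simp) (.inl rfl))
      obtain ⟨y, N', hy⟩ := ih (st, a, ⟨ψ', ρ⟩) (.move (by simp [Node.im]) (by simp) (.inl rfl))
      exact ⟨.and x y, max N N', fun k hk => by
        simp [run, hx k (by omega), hy k (by omega)]⟩
    | or ψ ψ' =>
      obtain ⟨x, N, hx⟩ := ih (st, a, ⟨ψ, ρ⟩) (.move (by simp [Node.im]) (by simp) (.inl rfl))
      obtain ⟨y, N', hy⟩ := ih (st, a, ⟨ψ', ρ⟩) (.move (by simp [Node.im]) (by simp) (.inl rfl))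
      exact ⟨.or x y, max N N', fun k hk => by
        simp [run, hx k (by omega), hy k (by omega)]⟩
    | box ψ =>
      obtain ⟨l, N, hl⟩ := exists_mapM_eq_some (f := fun k a' => run m k st a' ⟨ψ, ρ⟩)
        (l := a.im) fun a' ha' => ih (st, a', ⟨ψ, ρ⟩)
          (.move (by simp [Node.im]) (by simp) (.inr ha'))
      exact ⟨if a.isModal then .box (conj l) else conj l, N, fun k hk => by simp [run, hl k hk]⟩
    | dia ψ =>
      obtain ⟨l, N, hl⟩ := exists_mapM_eq_some (f := fun k a' => run m k st a' ⟨ψ, ρ⟩)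
        (l := a.im) fun a' ha' => ih (st, a', ⟨ψ, ρ⟩)
          (.move (by simp [Node.im]) (by simp) (.inr ha'))
      exact ⟨if a.isModal then .dia (disj l) else disj l, N, fun k hk => by simp [run, hl k hk]⟩
    | var i =>
      rcases he : ρ.drop i with _ | ⟨⟨p, β⟩, ρ'⟩
      · exact ⟨.bot, 0, fun k _ => by simp [run, he]⟩
      · cases hl : lookup a ⟨β, (p, β) :: ρ'⟩ st with
        | some j => exact ⟨.var j, 0, fun k _ => by simp [run, he, hl]⟩
        | none =>
          obtain ⟨x, N, hx⟩ := ih ((a, ⟨β, (p, β) :: ρ'⟩) :: st, a, ⟨β, (p, β) :: ρ'⟩)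
            (.push (by rw [Node.im_of_drop he]; simp) (by simp [rank, Node.lead, he])
              fun _ => hl)
          exact ⟨.fix p x, N, fun k hk => by simp [run, he, hl, hx k hk]⟩
    | fix p β =>
      obtain ⟨x, N, hx⟩ := ih ((a, ⟨β, (p, β) :: ρ⟩) :: st, a, ⟨β, (p, β) :: ρ⟩)
        (.push (by simp [Node.im]) rfl (by simp))
      exact ⟨.fix p x, N, fun k hk => by simp [run, hx k hk]⟩

end Product


/-! ### The product and the game tree -/

namespace Product

/-- The environment of a node of the product matches the list of open binders. -/
inductive Opens (m : ℕ) : List (ℕ × Ranked) → List (Node × Node) → Prop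
  | nil : Opens m [] []
  | cons {τ st a x β} : Opens m τ st → Computes m ((a, x) :: st) a x β →
      Opens m ((rank x, β) :: τ) ((a, x) :: st)

/-- The node `c` of the product is reached by the computation of `a × b`. -/
def Rel (m : ℕ) (a b c : Node) : Prop :=
  ∃ st, Computes m st a b c.fml ∧ Opens m c.env st

/-- Unfolding variable `j` of the product leads to the formula computed when entry `j` of the stack
was opened, in the environment of that time. -/
theorem Opens.drop {m : ℕ} {τ : List (ℕ × Ranked)} {st : List (Node × Node)} (h : Opens m τ st)
    {a x : Node} {j : ℕ} (hj : st[j]? = some (a, x)) :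
    ∃ β τ', τ.drop j = (rank x, β) :: τ' ∧ Rel m a x ⟨β, (rank x, β) :: τ'⟩ := by
  induction h generalizing j with
  | nil => simp at hj
  | @cons τ st a' x' β h hc ih =>
    cases j with
    | zero =>
      simp only [List.getElem?_cons_zero, Option.some.injEq, Prod.mk.injEq] at hj
      obtain ⟨rfl, rfl⟩ := hj
      exact ⟨β, τ, rfl, _, hc, .cons h hc⟩
    | succ j => exact ih hj

/-- The product does not branch at the pair of `a` and `b`. -/
def Idle (a b : Node) : Prop :=
  b.isModal = true ∧ a.isModal = false ∧ a.im.length = 1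

theorem Rel.idle {m : ℕ} {a b c : Node} (h : Rel m a b c) (hi : Idle a b) :
    ∃ a' b', a.im = [a'] ∧ b.im = [b'] ∧ Rel m a' b' c := by
  obtain ⟨st, hc, ho⟩ := h
  obtain ⟨h1, h2, h3⟩ := hi
  generalize hφ : c.fml = φ at hc
  cases hc with
  | boxOne _ h hx => exact ⟨_, _, h, rfl, st, hφ ▸ hx, ho⟩
  | diaOne _ h hx => exact ⟨_, _, h, rfl, st, hφ ▸ hx, ho⟩
  | boxModal h => simp [h] at h2
  | diaModal h => simp [h] at h2
  | boxNil _ h => simp [h] at h3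
  | diaNil _ h => simp [h] at h3
  | boxTwo _ h => simp [h] at h3
  | diaTwo _ h => simp [h] at h3
  | _ => simp [Node.isModal] at h1

theorem im_of_isLeaf {c : Node} (h : c.fml.IsLeaf) :
    c.im = [] ∧ c.isModal = false ∧ c.lead = 0 := by
  rcases c with ⟨φ, τ⟩
  cases φ <;> simp_all [Fml.IsLeaf, Node.im, Node.isModal, Node.lead]

/-- In the three cases, `Win` moves alone, or its modality selects an immediate subformula of a
non-modal `a`, or both are modal and the state of `T` changes. The claim is about `lead` and not
`prio` because of `varOpen`, where a binder of the product faces a variable of `Win`. -/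
theorem Rel.moves {m : ℕ} {a b c : Node} (h : Rel m a b c) (hi : ¬ Idle a b) :
    b.lead = c.lead ∧
    ((b.isModal = false ∧ c.isModal = false ∧ List.Forall₂ (Rel m a) b.im c.im) ∨
      (b.isModal = true ∧ a.isModal = false ∧ c.isModal = false ∧
        ∃ b', b.im = [b'] ∧ List.Forall₂ (fun a' => Rel m a' b') a.im c.im) ∨
      (b.isModal = true ∧ a.isModal = true ∧ c.isModal = true ∧
        ∃ a' b' c', a.im = [a'] ∧ b.im = [b'] ∧ c.im = [c'] ∧ Rel m a' b' c')) := by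
  obtain ⟨st, hc, ho⟩ := h
  rcases c with ⟨φ, τ⟩
  dsimp only at hc ho
  cases hc with
  | @pos _ _ P =>
    obtain ⟨h1, h2, h3⟩ := im_of_isLeaf (c := ⟨atom m a P, τ⟩) (isLeaf_atom _ _ _)
    exact ⟨h3.symm, .inl ⟨rfl, h2, by rw [h1]; exact .nil⟩⟩
  | @neg _ _ P =>
    obtain ⟨h1, h2, h3⟩ := im_of_isLeaf (c := ⟨compl (atom m a P), τ⟩)
      (isLeaf_compl (isLeaf_atom _ _ _))
    exact ⟨h3.symm, .inl ⟨rfl, h2, by rw [h1]; exact .nil⟩⟩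
  | bot => exact ⟨rfl, .inl ⟨rfl, rfl, .nil⟩⟩
  | top => exact ⟨rfl, .inl ⟨rfl, rfl, .nil⟩⟩
  | and hx hy =>
    exact ⟨rfl, .inl ⟨rfl, rfl, .cons ⟨st, hx, ho⟩ (.cons ⟨st, hy, ho⟩ .nil)⟩⟩
  | or hx hy =>
    exact ⟨rfl, .inl ⟨rfl, rfl, .cons ⟨st, hx, ho⟩ (.cons ⟨st, hy, ho⟩ .nil)⟩⟩
  | boxModal hm h hx =>
    exact ⟨rfl, .inr (.inr ⟨rfl, hm, rfl, _, _, _, h, rfl, rfl, st, hx, ho⟩)⟩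
  | diaModal hm h hx =>
    exact ⟨rfl, .inr (.inr ⟨rfl, hm, rfl, _, _, _, h, rfl, rfl, st, hx, ho⟩)⟩
  | boxNil hm h => exact ⟨rfl, .inr (.inl ⟨rfl, hm, rfl, _, rfl, by rw [h]; exact .nil⟩)⟩
  | diaNil hm h => exact ⟨rfl, .inr (.inl ⟨rfl, hm, rfl, _, rfl, by rw [h]; exact .nil⟩)⟩
  | boxOne hm h => exact absurd ⟨rfl, hm, by rw [h]; rfl⟩ hi
  | diaOne hm h => exact absurd ⟨rfl, hm, by rw [h]; rfl⟩ hi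
  | boxTwo hm h hx hy =>
    exact ⟨rfl, .inr (.inl ⟨rfl, hm, rfl, _, rfl, by
      rw [h]; exact .cons ⟨st, hx, ho⟩ (.cons ⟨st, hy, ho⟩ .nil)⟩)⟩
  | diaTwo hm h hx hy =>
    exact ⟨rfl, .inr (.inl ⟨rfl, hm, rfl, _, rfl, by
      rw [h]; exact .cons ⟨st, hx, ho⟩ (.cons ⟨st, hy, ho⟩ .nil)⟩)⟩
  | varNone he =>
    exact ⟨by simp [Node.lead, he], .inl ⟨rfl, rfl, by simp [Node.im, he]⟩⟩
  | @varFound _ _ i ρ p β ρ' j he hl =>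
    obtain ⟨γ, τ', ht, hr⟩ := ho.drop (lookup_eq_some hl).1
    refine ⟨?_, .inl ⟨rfl, rfl, ?_⟩⟩
    · simp only [Node.lead, he, ht]
      rfl
    · rw [Node.im_of_drop he, Node.im_of_drop ht]
      exact .cons hr .nil
  | @varOpen _ _ i ρ p β ρ' x he hl hx =>
    refine ⟨by simp [Node.lead, he], .inl ⟨rfl, rfl, ?_⟩⟩
    rw [Node.im_of_drop he]
    exact .cons ⟨_, hx, .cons ho hx⟩ .nil
  | fix hx => exact ⟨rfl, .inl ⟨rfl, rfl, .cons ⟨_, hx, .cons ho hx⟩ .nil⟩⟩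

/-- Literals and constants belong to Odd exactly when they are true, so this is the correctness of
`φ × P`. If `φ` is itself a literal, the owner of its position is its truth value, whence the
literal for `O m` and its complement for `E m`. -/
theorem oddAt_atom (L : Set PropVar) (m : ℕ) (a : Node) (P : PropVar)
    (τ : List (ℕ × Ranked)) :
    Node.OddAt L ⟨atom m a P, τ⟩ ↔
      (P = .E (a.prio m) ∧ ¬ a.OddAt L) ∨ (P = .O (a.prio m) ∧ a.OddAt L) ∨
        (P = .M ∧ a.isModal = true) := by
  rcases a with ⟨φ, ρ⟩
  cases φ
  case var => simp only [atom, ofBool, Node.isModal]; split_ifs <;> simp_all [Node.OddAt]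
  all_goals
    simp only [atom, ofBool, Node.OddAt, Node.isModal, Node.prio]
    split_ifs <;> simp_all

theorem oddAt_compl_atom (L : Set PropVar) (m : ℕ) (a : Node) (P : PropVar)
    (τ : List (ℕ × Ranked)) :
    Node.OddAt L ⟨compl (atom m a P), τ⟩ ↔ ¬ Node.OddAt L ⟨atom m a P, τ⟩ := by
  have := isLeaf_atom m a P
  generalize atom m a P = φ at *
  cases φ <;> simp_all [Fml.IsLeaf, compl, Node.OddAt]

theorem Rel.oddAt {m : ℕ} {a b c : Node} (h : Rel m a b c) (hi : ¬ Idle a b) {L L' : Set PropVar}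
    (hL : ∀ P, P ∈ L' ↔ (P = .E (a.prio m) ∧ ¬ a.OddAt L) ∨ (P = .O (a.prio m) ∧ a.OddAt L) ∨
        (P = .M ∧ a.isModal = true)) :
    b.OddAt L' ↔ c.OddAt L := by
  obtain ⟨st, hc, ho⟩ := h
  rcases c with ⟨φ, τ⟩
  dsimp only at hc ho
  cases hc with
  | pos => rw [oddAt_atom, ← hL]; rfl
  | neg => rw [oddAt_compl_atom, oddAt_atom, ← hL]; rfl
  | boxOne hm h => exact absurd ⟨rfl, hm, by rw [h]; rfl⟩ hi
  | diaOne hm h => exact absurd ⟨rfl, hm, by rw [h]; rfl⟩ hi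
  | _ => exact Iff.rfl

end Product

/-! ### The stuttering bisimulation between the two games -/

theorem _root_.List.Forall₂.exists_of_mem_right {α β : Type*} {R : α → β → Prop} {l : List α}
    {l' : List β} (h : List.Forall₂ R l l') {y : β} (hy : y ∈ l') : ∃ x ∈ l, R x y :=
  h.flip.exists_of_mem_left hy

/-- A counter that is increased at all times that are not idle takes all values at such times. -/
theorem tendsto_and_frequently_of_stutter {κ : ℕ → ℕ} {idle : ℕ → Prop} (hκ : κ 0 = 0)
    (h1 : ∀ n, idle n → κ (n + 1) = κ n) (h2 : ∀ n, ¬ idle n → κ (n + 1) = κ n + 1)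
    (hex : ∀ N, ∃ n ≥ N, ¬ idle n) :
    Tendsto κ atTop atTop ∧ ∀ {P : ℕ → Prop}, (∃ᶠ j in atTop, P j) →
      ∃ᶠ n in atTop, ¬ idle n ∧ P (κ n) := by
  have hmono : Monotone κ := monotone_nat_of_le_succ fun n => by
    by_cases hi : idle n
    · exact (h1 n hi).ge
    · rw [h2 n hi]; omega
  have hnext : ∀ N, ∃ n ≥ N, κ n = κ N ∧ ¬ idle n := by
    intro N
    obtain ⟨n, hn, hi⟩ := hex N
    obtain ⟨k, rfl⟩ := Nat.exists_eq_add_of_le hn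
    clear hn
    induction k generalizing N with
    | zero => exact ⟨N, le_rfl, rfl, hi⟩
    | succ k ih =>
      by_cases hN : idle N
      · obtain ⟨n, hn, h, h'⟩ := ih (N + 1) (by rwa [Nat.add_right_comm])
        exact ⟨n, by omega, h.trans (h1 N hN), h'⟩
      · exact ⟨N, le_rfl, rfl, hN⟩
  have hsurj : ∀ j, ∃ n, κ n = j ∧ ¬ idle n := by
    intro j
    induction j with
    | zero =>
      obtain ⟨n, _, h, h'⟩ := hnext 0
      exact ⟨n, h.trans hκ, h'⟩
    | succ j ih =>
      obtain ⟨n, rfl, hi⟩ := ih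
      obtain ⟨n', _, h, h'⟩ := hnext (n + 1)
      exact ⟨n', h.trans (h2 n hi), h'⟩
  refine ⟨tendsto_atTop_atTop.2 fun b => ?_, fun {P} hP => frequently_atTop.2 fun N => ?_⟩
  · obtain ⟨n, rfl, _⟩ := hsurj b
    exact ⟨n, fun k hk => hmono hk⟩
  · obtain ⟨j, hj, hPj⟩ := frequently_atTop.1 hP (κ N + 1)
    obtain ⟨n, rfl, hi⟩ := hsurj j
    refine ⟨n, ?_, hi, hPj⟩
    by_contra! hlt
    have := hmono hlt.le
    omega

-- The relation ignores the path that leads to a position of the game tree and keeps only its end.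
-- An idle move passes a modality of `Win` and thereby shrinks its formula, which bounds the pauses.
open Product in
theorem evenWins_product_iff {T : Struct} {m m' : ℕ} {ΩΨ ΩWin ΩΦ : Ranked}
    (hl : ΩWin.AllLabels (m' ≤ ·)) (ho : ΩWin.OrderPreserving)
    (hl' : ΩΦ.AllLabels (m' ≤ ·)) (ho' : ΩΦ.OrderPreserving)
    (h : Computes m [] (Node.root ΩΨ) (Node.root ΩWin) ΩΦ) :
    (arena (gameTree T m ΩΨ) m' ΩWin).EvenWins ↔ (arena T m' ΩΦ).EvenWins := by
  have hsize : ∀ {u u' : (arena (gameTree T m ΩΨ) m' ΩWin).V}, Idle u.1.1.2 u.2 →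
      (arena (gameTree T m ΩΨ) m' ΩWin).edge u u' → sizeOf u'.2.fml < sizeOf u.2.fml := by
    intro u u' hi he
    refine Node.sizeOf_im he.1 fun i hv => ?_
    have := hi.1
    simp [Node.isModal, hv] at this
  refine ParityGame.StutterBisim.evenWins_iff
    { R := fun u v => u.1.1.1 = v.1 ∧ Rel m u.1.1.2 u.2 v.2
      idle := fun u => Idle u.1.1.2 u.2
      size := fun u => sizeOf u.2.fml
      init := ⟨rfl, [], h, .nil⟩
      size_idle := hsize
      rel_idle := ?_
      exists_idle := ?_
      odd_iff := ?_
      forth := ?_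
      back := ?_
      dominant_iff := ?_ }
  · rintro ⟨⟨⟨s, a⟩, w⟩, b⟩ ⟨⟨⟨s', a'⟩, w'⟩, b'⟩ ⟨_, c⟩ ⟨rfl, hR⟩ hi ⟨hb, he⟩
    dsimp only at hi hR hb he ⊢
    rw [if_pos hi.1] at he
    obtain ⟨⟨ha, hs⟩, -⟩ := he
    dsimp only at ha hs
    rw [if_neg (by simp [hi.2.1])] at hs
    obtain ⟨a₁, b₁, h1, h2, h3⟩ := hR.idle hi
    rw [h1, List.mem_singleton] at ha
    rw [h2, List.mem_singleton] at hb
    subst ha hb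
    exact ⟨hs, h3⟩
  · rintro ⟨⟨⟨s, a⟩, w⟩, b⟩ ⟨_, c⟩ ⟨rfl, hR⟩ hi
    dsimp only at hi hR
    obtain ⟨a₁, b₁, h1, h2, h3⟩ := hR.idle hi
    have he : (arena T m ΩΨ).edge (s, a) (s, a₁) :=
      ⟨by simp [h1], by simp [hi.2.1]⟩
    refine ⟨(⟨(s, a₁), .step w he⟩, b₁), by simp [h2], ?_⟩
    rw [if_pos hi.1]
    exact ⟨he, rfl⟩
  · rintro ⟨⟨⟨s, a⟩, w⟩, b⟩ ⟨_, c⟩ ⟨rfl, hR⟩ hi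
    exact hR.oddAt hi fun P => Iff.rfl
  · rintro ⟨⟨⟨s, a⟩, w⟩, b⟩ ⟨⟨⟨s', a'⟩, w'⟩, b'⟩ ⟨_, c⟩ ⟨rfl, hR⟩ hi ⟨hb, he⟩
    dsimp only at hi hR hb he ⊢
    rcases (hR.moves hi).2 with ⟨m1, m2, hF⟩ | ⟨m1, m2, m3, b₁, h1, hF⟩ |
      ⟨m1, m2, m3, a₁, b₁, c₁, h1, h2, h3, hR'⟩
    · rw [if_neg (by simp [m1])] at he
      obtain ⟨c', hc, hR'⟩ := hF.exists_of_mem_left hb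
      injection he with he
      obtain ⟨rfl, rfl⟩ := Prod.mk.inj he
      exact ⟨(s', c'), ⟨hc, by simp [m2]⟩, rfl, hR'⟩
    · rw [if_pos m1] at he
      obtain ⟨⟨ha, hs⟩, -⟩ := he
      dsimp only at ha hs
      rw [if_neg (by simp [m2])] at hs
      rw [h1, List.mem_singleton] at hb
      obtain ⟨c', hc, hR'⟩ := hF.exists_of_mem_left ha
      exact ⟨(s', c'), ⟨hc, by simp [m3, hs]⟩, rfl, hb ▸ hR'⟩
    · rw [if_pos m1] at he
      obtain ⟨⟨ha, hs⟩, -⟩ := he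
      dsimp only at ha hs
      rw [if_pos m2] at hs
      rw [h2, List.mem_singleton] at hb
      rw [h1, List.mem_singleton] at ha
      subst ha hb
      exact ⟨(s', c₁), ⟨by simp [h3], by simpa [m3] using hs⟩, rfl, hR'⟩
  · rintro ⟨⟨⟨s, a⟩, w⟩, b⟩ ⟨_, c⟩ ⟨s', c'⟩ ⟨rfl, hR⟩ hi ⟨hc, he⟩
    dsimp only at hi hR hc he ⊢
    rcases (hR.moves hi).2 with ⟨m1, m2, hF⟩ | ⟨m1, m2, m3, b₁, h1, hF⟩ |
      ⟨m1, m2, m3, a₁, b₁, c₁, h1, h2, h3, hR'⟩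
    · rw [if_neg (by simp [m2])] at he
      obtain ⟨b', hb, hR'⟩ := hF.exists_of_mem_right hc
      refine ⟨(⟨(s, a), w⟩, b'), ⟨hb, ?_⟩, he.symm, hR'⟩
      rw [if_neg (by simp [m1])]
    · rw [if_neg (by simp [m3])] at he
      obtain ⟨a', ha, hR'⟩ := hF.exists_of_mem_right hc
      have hE : (arena T m ΩΨ).edge (s, a) (s, a') := ⟨ha, by simp [m2]⟩
      refine ⟨(⟨(s, a'), .step w hE⟩, b₁), ⟨by simp [h1], ?_⟩, he.symm, hR'⟩
      rw [if_pos m1]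
      exact ⟨hE, rfl⟩
    · rw [if_pos m3] at he
      rw [h3, List.mem_singleton] at hc
      subst hc
      have hE : (arena T m ΩΨ).edge (s, a) (s', a₁) := ⟨by simp [h1], by simpa [m2] using he⟩
      refine ⟨(⟨(s', a₁), .step w hE⟩, b₁), ⟨by simp [h2], ?_⟩, rfl, hR'⟩
      rw [if_pos m1]
      exact ⟨hE, rfl⟩
  · intro π π' κ hπ hπ' hκ h1 h2 hR
    obtain ⟨h0, ha⟩ := im_of_isPlay hπ
    obtain ⟨h0', ha'⟩ := im_of_isPlay hπ'
    obtain ⟨p, β, ρ, hj, -, hle⟩ := Node.exists_top ho h0 ha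
    obtain ⟨p', β', ρ', hj', -, hle'⟩ := Node.exists_top ho' h0' ha'
    rw [evenDominant_arena_iff hl hπ hj hle, evenDominant_arena_iff hl' hπ' hj' hle']
    have hnot : ∀ {n E}, (π n).2.Jumps E → ¬ Idle (π n).1.1.2 (π n).2 := by
      rintro n E ⟨i, hi, _⟩ hI
      have := hI.1
      simp [Node.isModal, hi] at this
    have hlead : ∀ n, ¬ Idle (π n).1.1.2 (π n).2 → (π n).2.lead = (π' (κ n)).2.lead :=
      fun n hi => ((hR n).2.moves hi).1
    obtain ⟨hlim, hfreq⟩ := tendsto_and_frequently_of_stutter (idle := fun n => Idle (π n).1.1.2 (π n).2) hκ h1 h2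
      fun N => by
        obtain ⟨n, hn, hj⟩ := frequently_atTop.1 hj N
        exact ⟨n, hn, hnot hj⟩
    -- The topmost variables on both sides are unfolded at non-idle times, where the leads agree; so
    -- each of the two priorities is eventually bounded by the other.
    have e1 : p ≤ p' := by
      obtain ⟨n, hn, hn'⟩ := (hj.and_eventually (hlim.eventually hle')).exists
      rwa [← hlead n (hnot hn), hn.lead_eq] at hn'
    have e2 : p' ≤ p := by
      obtain ⟨n, ⟨hi, hn⟩, hn'⟩ := ((hfreq hj').and_eventually hle).exists
      rwa [hlead n hi, hn.lead_eq] at hn'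
    rw [le_antisymm e1 e2]

end LMu

theorem mainTheorem1 (Ψ Win : LMu.Formula) (hΨ : Ψ.IsSentence) (hWin : Win.IsSentence)
    (m q : ℕ) (ΩΨ : LMu.Ranked) (hΩΨ : LMu.IsPriorityAssignment m q ΩΨ Ψ)
    (m' q' : ℕ) (ΩWin : LMu.Ranked) (hΩWin : LMu.IsPriorityAssignment m' q' ΩWin Win)
    (hord : ΩWin.OrderPreserving)
    (hint : LMu.Interprets Win Ψ m ΩΨ) :
    ∃ (Φ : LMu.Formula) (ΩΦ : LMu.Ranked),
      LMu.ProductHaltsWith m ΩΨ ΩWin ΩΦ ∧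
      Φ.IsSentence ∧
      LMu.IsPriorityAssignment m' q' ΩΦ Φ ∧
      ΩΦ.OrderPreserving ∧
      (Ψ.Guarded → Win.Guarded → Φ.Guarded) ∧
      LMu.Equivalent Ψ Φ := by
  -- On the side of `Ψ`, termination rests only on the finiteness of the set of reachable nodes.
  obtain ⟨S, hS, hr, hcl⟩ := LMu.Node.exists_finite_closed ΩΨ
  obtain ⟨ΩΦ, N, hrun⟩ := LMu.Product.exists_run_eq_some m
    (LMu.Product.acc_calls hord (LMu.Node.root ΩΨ) hS hr hcl)
  have hc := LMu.Product.computes_of_run (hrun N le_rfl)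
  have ho : ΩΦ.OrderPreserving := hc.orderPreservingIn
  have hΩΦ : LMu.IsPriorityAssignment m' q' ΩΦ ΩΦ.erase :=
    ⟨hΩWin.le_one, rfl, hc.allLabels (LMu.Node.labelsIn_root hΩWin.mem)⟩
  refine ⟨ΩΦ.erase, ΩΦ, ⟨N, hrun⟩, fun i hi => ?_, hΩΦ, ho, fun h1 h2 => ?_, fun T hT => ?_⟩
  · obtain ⟨e, he, _⟩ := hc.exists_of_freeIn (LMu.Fml.freeIn_erase.1 hi)
    simp at he
  · rw [← hΩΨ.erase_eq, LMu.Fml.guarded_erase] at h1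
    rw [← hΩWin.erase_eq, LMu.Fml.guarded_erase] at h2
    exact LMu.Fml.guarded_erase.2
      (hc.guarded (LMu.Node.guardedIn_root h1) (LMu.Node.guardedIn_root h2)).1
  -- Both instances of `Sat` are evaluated with the assignments at hand, `ΩWin` and `ΩΦ`, whose
  -- games the bisimulation compares.
  · rw [hint T hT, LMu.sat_iff_evenWins hΩWin hord, LMu.sat_iff_evenWins hΩΦ ho]
    exact LMu.evenWins_product_iff (hΩWin.mem.mono fun _ h => h.1) hord
      (hΩΦ.mem.mono fun _ h => h.1) ho hc
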